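/- Let $k\ge 1$ and $0<\alpha,\beta\le 1$. For $n\ge 0$ let $\Theta(k,n)=\{(n_1,\dots,n_k)\in\mathbb{N}_0^k:\sum_{j=1}^k jn_j=n\}$. For rates $\lambda=(\lambda_1,\dots,\lambda_k)$ with all $\lambda_j>0$, a generalized Poisson random field (GPRF) on $\mathbb{R}_+^2$ is a process $\{M(s,t)\}$ with values in $\mathbb{N}_0$ and almost surely right-continuous paths (with respect to $[s,\infty)\times[t,\infty)$; this holds if $M(s,t)$ is the mass of $[0,s]\times[0,t]$ under an integer-valued random measure) such that $M(0,t)=M(s,0)=0$ a.s., its increments $M(s',t')-M(s',t)-M(s,t')+M(s,t)$ over disjoint rectangles $(s,s']\times(t,t']$ are independent, and for $s<s'$, $t<t'$ and $n\ge0$ such an increment equals $n$ with probability $\sum_{\Theta(k,n)}\prod_{j=1}^k\frac{(\lambda_j a)^{n_j}}{n_j!}e^{-\lambda_j a}$, where $a=(s'-s)(t'-t)$. For $0<\alpha<1$, a stable subordinator $H^\alpha$ is a real Lévy process with a.s. non-decreasing paths and $\mathbb{E}e^{-uH^\alpha(t)}=e^{-tu^\alpha}$, $u>0$, and $L^\alpha(t)=\inf\{s\ge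 0:H^\alpha(s)\ge t\}$ is an inverse stable subordinator; for $\alpha=1$, $L^\alpha(t)=t$ a.s. Let $M,L^\alpha,L^\beta$ be independent, let $M^{\alpha,\beta}(s,t)=M(L^\alpha(s),L^\beta(t))$, and put $p^{\alpha,\beta}(n,s,t)=\Pr\{M^{\alpha,\beta}(s,t)=n\}$ for $n\in\mathbb{Z}$, so that $p^{\alpha,\beta}(n,s,t)=0$ for $n<0$. Let $$ {}_2\Psi_2\left[\begin{matrix}(a_1,\alpha_1),(a_2,\alpha_2)\\(b_1,\beta_1),(b_2,\beta_2)\end{matrix}\,\Big|\,x\right]=\sum_{r=0}^\infty\frac{\Gamma(\alpha_1r+a_1)\Gamma(\alpha_2r+a_2)}{\Gamma(\beta_1r+b_1)\Gamma(\beta_2r+b_2)}\,\frac{x^r}{r!} $$ be the generalized Wright function, which is defined where this series converges. (1) For all $n\ge0$ and $s,t\ge0$ for which the series of the generalized Wright functions below converge, $$p^{\alpha,\beta}(n,s,t)=\sum_{\Theta(k,n)}\prod_{j=1}^k\frac{(\lambda_js^\alpha t^\beta)^{n_j}}{n_j!}\;{}_2\Psi_2\left[\begin{matrix}(\sum_jn_j+1,1),(\sum_jn_j+1,1)\\(\alpha\sum_jn_j+1,\alpha),(\beta\sum_jn_j+1,\beta)\end{matrix}\,\Big|\,-\sum_{j=1}^k\lambda_js^\alpha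 t^\beta\right].$$ If $\alpha+\beta>1$, then these series converge for every real argument, so the formula holds for all $n\ge 0$ and $s,t\ge0$. (2) For all $\alpha,\beta\in(0,1]$, $n\ge0$ and $s,t>0$, the derivatives below exist and $$\frac{\partial^{\alpha+\beta}}{\partial t^\beta\partial s^\alpha}p^{\alpha,\beta}(n,s,t)=-\sum_{j=1}^k\lambda_j(I-B^j)\Big(1+\sum_{j'=1}^k\lambda_{j'}\sum_{r=1}^{j'}B^{j'-r}\frac{\partial}{\partial\lambda_1}\Big)p^{\alpha,\beta}(n,s,t),$$ with $p^{\alpha,\beta}(0,0,0)=1$. Here $B^jp^{\alpha,\beta}(n,s,t)=p^{\alpha,\beta}(n-j,s,t)$, $\partial/\partial\lambda_1$ is the partial derivative of $p^{\alpha,\beta}$ as a function of the rates, and $\frac{\partial^{\alpha+\beta}}{\partial t^\beta\partial s^\alpha}$ is the Caputo derivative of order $\alpha$ in $s$ followed by that of order $\beta$ in $t$, where $\frac{d^\alpha}{dt^\alpha}f(t)=\frac1{\Gamma(1-\alpha)}\int_0^t\frac{f'(\tau)}{(t-\tau)^\alpha}\,d\tau$ for $0<\alpha<1$ and $\frac{d}{dt}f(t)=f'(t)$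 for $\alpha=1$. -/

import Mathlib

open MeasureTheory ProbabilityTheory Filter Set
open scoped NNReal Topology

universe u

/-! ### Combinatorics and special functions -/

/-- `Θ(k,n)`: the tuples `(n₁, …, n_k)` of non-negative integers with `∑ j n_j = n`.
The index `j : Fin k` stands for the number `j + 1`. -/
def Theta (k n : ℕ) : Finset (Fin k → ℕ) :=
  (Fintype.piFinset fun _ : Fin k => Finset.range (n + 1)).filter
    fun ν => ∑ j : Fin k, ((j : ℕ) + 1) * ν j = n

/-- The bound `n_j ≤ n` in the definition of `Theta` excludes nothing. -/
theorem mem_Theta {k n : ℕ} {ν : Fin k → ℕ} :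
    ν ∈ Theta k n ↔ ∑ j : Fin k, ((j : ℕ) + 1) * ν j = n := by
  simp only [Theta, Finset.mem_filter, Fintype.mem_piFinset, Finset.mem_range,
    and_iff_right_iff_imp]
  intro h j
  have h1 : ((j : ℕ) + 1) * ν j ≤ n := by
    rw [← h]
    exact Finset.single_le_sum (f := fun j : Fin k => ((j : ℕ) + 1) * ν j)
      (fun _ _ => Nat.zero_le _) (Finset.mem_univ j)
  nlinarith [Nat.zero_le ((j : ℕ) * ν j)]

/-- The `r`-th term of the series of the generalized Wright function `ₘΨₗ`, with upper parameters
`a i = (a_i, α_i)` and lower parameters `b j = (b_j, β_j)`. -/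
noncomputable def wrightTerm {m l : ℕ} (a : Fin m → ℝ × ℝ) (b : Fin l → ℝ × ℝ) (x : ℝ) (r : ℕ) :
    ℝ :=
  (∏ i, Real.Gamma ((a i).2 * r + (a i).1)) /
    ((∏ j, Real.Gamma ((b j).2 * r + (b j).1)) * (r.factorial : ℝ)) * x ^ r

/-- Convergence of the series of the generalized Wright function (limit of partial sums). -/
def WrightConverges {m l : ℕ} (a : Fin m → ℝ × ℝ) (b : Fin l → ℝ × ℝ) (x : ℝ) : Prop :=
  Summable (wrightTerm a b x) (SummationFilter.conditional ℕ)

/-- The generalized Wright function `ₘΨₗ`, as the limit of the partial sums of its series. -/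
noncomputable def generalizedWright {m l : ℕ} (a : Fin m → ℝ × ℝ) (b : Fin l → ℝ × ℝ) (x : ℝ) : ℝ :=
  ∑'[SummationFilter.conditional ℕ] r, wrightTerm a b x r

/-- The upper parameters `(N+1, 1), (N+1, 1)`. -/
def wrightUpper (N : ℕ) : Fin 2 → ℝ × ℝ :=
  ![((N : ℝ) + 1, 1), ((N : ℝ) + 1, 1)]

/-- The lower parameters `(α N + 1, α), (β N + 1, β)`. -/
noncomputable def wrightLower (α β : ℝ) (N : ℕ) : Fin 2 → ℝ × ℝ :=
  ![(α * N + 1, α), (β * N + 1, β)]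

/-! ### Caputo fractional derivatives -/

/-- The Caputo derivative of order `α ∈ (0, 1]` at the point `t > 0`. -/
noncomputable def caputoDeriv (α : ℝ) (f : ℝ → ℝ) (t : ℝ) : ℝ :=
  if α = 1 then deriv f t
  else 1 / Real.Gamma (1 - α) * ∫ τ in (0 : ℝ)..t, deriv f τ / (t - τ) ^ α

/-- The Caputo derivative of order `α` of `f` at `t > 0` exists: every operation in its definition
is meaningful. -/
def CaputoDifferentiableAt (α : ℝ) (f : ℝ → ℝ) (t : ℝ) : Prop :=
  if α = 1 then DifferentiableAt ℝ f t
  else (∀ τ ∈ Ioo 0 t, DifferentiableAt ℝ f τ) ∧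
    IntervalIntegrable (fun τ => deriv f τ / (t - τ) ^ α) volume 0 t

/-! ### The processes -/

section Processes

/-- The increment of a two-parameter integer-valued process over `(s, s'] × (t, t']`. -/
def rectInc {Ω : Type*} (M : ℝ≥0 → ℝ≥0 → Ω → ℕ) (s t s' t' : ℝ≥0) (ω : Ω) : ℤ :=
  (M s' t' ω : ℤ) - M s' t ω - M s t' ω + M s t ω

/-- The law of the number of points of a generalized Poisson random field with rates
`l 0, …, l (k-1)` (that is `λ₁, …, λ_k`) in a region of area `a`. -/
noncomputable def gprfPmf {k : ℕ} (l : Fin k → ℝ) (a : ℝ) (n : ℕ) : ℝ :=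
  ∑ ν ∈ Theta k n, ∏ j, (l j * a) ^ ν j / ((ν j).factorial : ℝ) * Real.exp (-(l j * a))

/-- The generalized Poisson random field on the positive quadrant, as a two-parameter Lévy process
with rectangular increments. The field `rightCont` is the path property of
`M s t ω = N ω ([0,s] × [0,t])` for an integer-valued random measure `N`. -/
structure IsGPRF {Ω : Type*} [MeasurableSpace Ω] {k : ℕ} (l : Fin k → ℝ)
    (M : ℝ≥0 → ℝ≥0 → Ω → ℕ) (μ : Measure Ω) : Prop where
  rates_pos : ∀ j, 0 < l j
  meas : ∀ s t, Measurable (M s t)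
  zero_left : ∀ t, ∀ᵐ ω ∂μ, M 0 t ω = 0
  zero_right : ∀ s, ∀ᵐ ω ∂μ, M s 0 ω = 0
  law_inc : ∀ s t s' t' : ℝ≥0, s < s' → t < t' → ∀ n : ℕ,
    μ.real {ω | rectInc M s t s' t' ω = n} =
      gprfPmf l (((s' : ℝ) - s) * ((t' : ℝ) - t)) n
  indep_inc : ∀ (m : ℕ) (s t s' t' : Fin m → ℝ≥0), (∀ i, s i ≤ s' i) → (∀ i, t i ≤ t' i) →
    Pairwise (fun i i' => Disjoint (Ioc (s i) (s' i) ×ˢ Ioc (t i) (t' i))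
      (Ioc (s i') (s' i') ×ˢ Ioc (t i') (t' i'))) →
    iIndepFun (fun i ω => rectInc M (s i) (t i) (s' i) (t' i) ω) μ
  rightCont : ∀ᵐ ω ∂μ, ∀ q : ℝ≥0 × ℝ≥0,
    ContinuousWithinAt (fun p : ℝ≥0 × ℝ≥0 => M p.1 p.2 ω) (Ici q) q

/-- Real-valued Lévy processes indexed by `[0, ∞)`. -/
structure IsLevyProcess {Ω : Type*} [MeasurableSpace Ω] (X : ℝ≥0 → Ω → ℝ) (μ : Measure Ω) :
    Prop where
  meas : ∀ t, Measurable (X t)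
  start : ∀ᵐ ω ∂μ, X 0 ω = 0
  indep_inc : HasIndepIncrements X μ
  stat_inc : ∀ t h, IdentDistrib (fun ω => X (t + h) ω - X t ω) (X h) μ μ
  stoch_cont : ∀ t, TendstoInMeasure μ X (𝓝 t) (X t)
  cadlag : ∀ᵐ ω ∂μ, ∀ t : ℝ≥0, ContinuousWithinAt (fun s => X s ω) (Ici t) t ∧
    ∃ x : ℝ, Tendsto (fun s => X s ω) (𝓝[<] t) (𝓝 x)

/-- The stable subordinator of index `α ∈ (0, 1)`: a Lévy process with almost surely
non-decreasing (hence almost surely non-negative) paths and `E exp(-v H(t)) = exp(-t v^α)`. -/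
structure IsStableSubordinator {Ω : Type*} [MeasurableSpace Ω] (α : ℝ) (H : ℝ≥0 → Ω → ℝ)
    (μ : Measure Ω) : Prop where
  index : α ∈ Ioo (0 : ℝ) 1
  levy : IsLevyProcess H μ
  mono : ∀ᵐ ω ∂μ, Monotone fun t => H t ω
  laplace : ∀ (t : ℝ≥0) (v : ℝ), 0 < v →
    ∫ ω, Real.exp (-v * H t ω) ∂μ = Real.exp (-(t : ℝ) * v ^ α)

/-- The inverse stable subordinator of index `α ∈ (0, 1]`: the hitting time process of a stable
subordinator if `α < 1`, and almost surely the identity if `α = 1`. -/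
def IsInverseStableSubordinator {Ω : Type*} [MeasurableSpace Ω] (α : ℝ) (L : ℝ≥0 → Ω → ℝ≥0)
    (μ : Measure Ω) : Prop :=
  (∃ H : ℝ≥0 → Ω → ℝ, IsStableSubordinator α H μ ∧
      ∀ t ω, L t ω = sInf {s : ℝ≥0 | (t : ℝ) ≤ H s ω}) ∨
    (α = 1 ∧ ∀ t, ∀ᵐ ω ∂μ, L t ω = t)

/-- The σ-algebra generated by a family of random elements. -/
abbrev processSigma {Ω T E : Type*} [MeasurableSpace E] (X : T → Ω → E) : MeasurableSpace Ω :=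
  MeasurableSpace.comap (fun ω t => X t ω) MeasurableSpace.pi

/-- `M`, `Lα`, `Lβ` are the components of a fractional generalized Poisson random field
`(s, t) ↦ M (Lα s) (Lβ t)`: a generalized Poisson random field with rates `l` and two inverse
stable subordinators of indices `α` and `β`, all three independent. -/
structure IsFGPRF {Ω : Type*} [MeasurableSpace Ω] {k : ℕ} (α β : ℝ) (l : Fin k → ℝ)
    (M : ℝ≥0 → ℝ≥0 → Ω → ℕ) (Lα Lβ : ℝ≥0 → Ω → ℝ≥0) (μ : Measure Ω) : Prop where
  gprf : IsGPRF l M μ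
  inv_left : IsInverseStableSubordinator α Lα μ
  inv_right : IsInverseStableSubordinator β Lβ μ
  indep : iIndep ![processSigma (fun q : ℝ≥0 × ℝ≥0 => M q.1 q.2), processSigma Lα,
    processSigma Lβ] μ

/-- The point probability `Pr{M(Lα(s), Lβ(t)) = n}` for an integer `n` (it is `0` for `n < 0`)
and real `s, t ≥ 0`. -/
noncomputable def fgprfProb {Ω : Type*} [MeasurableSpace Ω] (M : ℝ≥0 → ℝ≥0 → Ω → ℕ)
    (Lα Lβ : ℝ≥0 → Ω → ℝ≥0) (μ : Measure Ω) (n : ℤ) (s t : ℝ) : ℝ :=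
  μ.real {ω | (M (Lα s.toNNReal ω) (Lβ t.toNNReal ω) ω : ℤ) = n}

end Processes

/-! ### Operators on functions of the rates and of `n`

The functions are written `F : (Fin k → ℝ) → ℤ → ℝ`, with `F l n` the value at the rates `l`. -/

/-- The power `B^j` of the backward shift operator. -/
def backwardShift {k : ℕ} (j : ℕ) (F : (Fin k → ℝ) → ℤ → ℝ) : (Fin k → ℝ) → ℤ → ℝ :=
  fun l n => F l (n - j)

/-- The partial derivative `∂/∂λ₁`. -/
noncomputable def derivRateOne {k : ℕ} [NeZero k] (F : (Fin k → ℝ) → ℤ → ℝ) :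
    (Fin k → ℝ) → ℤ → ℝ :=
  fun l n => deriv (fun x => F (Function.update l 0 x) n) (l 0)

/-- The operator `1 + ∑_{j'} λ_{j'} ∑_{r=1}^{j'} B^{j'-r} ∂/∂λ₁`. -/
noncomputable def innerOperator {k : ℕ} [NeZero k] (F : (Fin k → ℝ) → ℤ → ℝ) :
    (Fin k → ℝ) → ℤ → ℝ :=
  fun l n => F l n + ∑ j' : Fin k, l j' * ∑ r ∈ Finset.Icc 1 ((j' : ℕ) + 1),
    backwardShift ((j' : ℕ) + 1 - r) (derivRateOne F) l n

/-- The operator `-∑_j λ_j (I - B^j) (1 + ∑_{j'} λ_{j'} ∑_{r=1}^{j'} B^{j'-r} ∂/∂λ₁)`. -/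
noncomputable def governingOperator {k : ℕ} [NeZero k] (F : (Fin k → ℝ) → ℤ → ℝ) :
    (Fin k → ℝ) → ℤ → ℝ :=
  fun l n => -∑ j : Fin k, l j *
    (innerOperator F l n - backwardShift ((j : ℕ) + 1) (innerOperator F) l n)

/-! Both parts follow from one mixture formula. A stable subordinator is self-similar, `H x` having
the law of `x^(1/α) H 1`, so `L s` has the law of `s^α ξ` with `ξ = (H 1)^(-α)`. Integrating the
Laplace transform of `H 1` against `v^(α r - 1)` shows that `ξ` has moments `r! / Γ(α r + 1)`, and
these determine its law (`IsMLLaw.ext`); for `α = 1` it is the point mass at `1`. Let `q_n(a)` be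
the probability of `n` points in area `a`. Conditioning on the independent time changes gives
`p(n,s,t) = E q_n(s^α t^β W)`, where `W = ξ η` is a product of independent Mittag-Leffler variables
(`IsFGPRF.exists_law`).

Part (1): expanding the exponential in `q_n` turns the moments of `W` into the terms of the Wright
series. If the series converges only conditionally, the exchange is made for the series damped by
`θ^r`, and `θ → 1` is handled by Abel's theorem on one side and dominated convergence on the other
(`IsMLLaw.generalizedWright_eq`).

Part (2): the series may diverge when `α + β ≤ 1`, so it is not differentiated. Instead, the Caputo
derivative of `s ↦ E f(s^α ξ)` is `E f'(s^α ξ)` (`IsMLLaw.caputo`): the chain rule and the Caputo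
kernel produce a mixture over `τ ∈ (0,s)` which, by a Beta integral, has the same moments as `s^α
ξ`. Used in `s` and then in `t`, with `c = s^α t^β`, this gives `E[q'(cW) + cW q''(cW)]`. With `D =
-∑ λ_j (I - B^j)` the forward equation is `q' = D q`, so the result is `E[Dq + cW D²q]`. On the
other side, `∂/∂λ₁` acts on `q(cW)` as `-cW (I - B)`, and `∑_r B^(j-r) (I - B)` telescopes to `I -
B^j`; the governing operator therefore yields the same expression (`governingOperator_integral`). -/

/-! ### Determinacy by moments -/

/-- The characteristic function of a measure on `[0, ∞)` as the power series of its moments. -/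
theorem charFun_eq_tsum_moments {ν : Measure ℝ} (h : ∀ᵐ x ∂ν, 0 ≤ x)
    (hi : ∀ r : ℕ, Integrable (fun x : ℝ => x ^ r) ν)
    (hs : ∀ v : ℝ, 0 ≤ v → Summable fun r : ℕ => v ^ r / (r.factorial : ℝ) * ∫ x, x ^ r ∂ν)
    (t : ℝ) :
    charFun ν t = ∑' r : ℕ, ((t : ℂ) * Complex.I) ^ r / (r.factorial : ℂ) *
      ((∫ x, x ^ r ∂ν : ℝ) : ℂ) := by
  rw [charFun_apply_real]
  have key := hasSum_integral_of_summable_integral_norm (μ := ν)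
    (F := fun (r : ℕ) (x : ℝ) => ((t : ℂ) * Complex.I) ^ r / (r.factorial : ℂ) * ((x ^ r : ℝ) : ℂ))
    (fun r => ((hi r).ofReal).const_mul _) ?_
  · have h1 : ∀ x : ℝ, Complex.exp (t * x * Complex.I) =
        ∑' r : ℕ, ((t : ℂ) * Complex.I) ^ r / (r.factorial : ℂ) * ((x ^ r : ℝ) : ℂ) := by
      intro x
      have := (NormedSpace.expSeries_div_hasSum_exp ((t : ℂ) * x * Complex.I)).tsum_eq
      rw [← Complex.exp_eq_exp_ℂ] at this
      rw [← this]
      refine tsum_congr fun r => ?_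
      push_cast
      rw [mul_pow, mul_pow, mul_pow]
      ring
    simp_rw [h1]
    rw [← key.tsum_eq]
    refine tsum_congr fun r => ?_
    rw [integral_const_mul, integral_complex_ofReal]
  · refine (hs |t| (abs_nonneg t)).congr fun r => ?_
    rw [← integral_const_mul]
    refine integral_congr_ae ?_
    filter_upwards [h] with x hx
    simp [abs_of_nonneg hx]

/-- The moments fix the characteristic function through its power series. Finite measures are
allowed because the mixture in `IsMLLaw.map_mix` is not known beforehand to have mass one. -/
theorem ext_of_moments {ν₁ ν₂ : Measure ℝ} [IsFiniteMeasure ν₁] [IsFiniteMeasure ν₂]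
    (h₁ : ∀ᵐ x ∂ν₁, 0 ≤ x) (h₂ : ∀ᵐ x ∂ν₂, 0 ≤ x)
    (i₁ : ∀ r : ℕ, Integrable (fun x : ℝ => x ^ r) ν₁)
    (i₂ : ∀ r : ℕ, Integrable (fun x : ℝ => x ^ r) ν₂)
    (h : ∀ r : ℕ, ∫ x, x ^ r ∂ν₁ = ∫ x, x ^ r ∂ν₂)
    (hs : ∀ v : ℝ, 0 ≤ v → Summable fun r : ℕ => v ^ r / (r.factorial : ℝ) * ∫ x, x ^ r ∂ν₁) :
    ν₁ = ν₂ := by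
  refine Measure.ext_of_charFun (funext fun t => ?_)
  rw [charFun_eq_tsum_moments h₁ i₁ hs, charFun_eq_tsum_moments h₂ i₂ (by simpa only [← h] using hs)]
  simp_rw [h]

/-! ### Convergence of the Wright series -/

/-- Log-convexity of `Γ` at `y + 1 = α (y + α) + (1 - α) (y + α + 1)`. -/
theorem Gamma_add_one_le {α y : ℝ} (hα : α ∈ Ioc (0 : ℝ) 1) (hy : 0 < y) :
    y * Real.Gamma y ≤ (y + α) ^ (1 - α) * Real.Gamma (y + α) := by
  have hg := Real.Gamma_pos_of_pos (show 0 < y + α by linarith [hα.1])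
  rw [← Real.Gamma_add_one hy.ne']
  rcases hα.2.eq_or_lt with rfl | h1
  · simp
  have h := Real.Gamma_mul_add_mul_le_rpow_Gamma_mul_rpow_Gamma (s := y + α) (t := y + α + 1)
    (a := α) (b := 1 - α) (by linarith [hα.1]) (by linarith [hα.1]) hα.1 (by linarith) (by ring)
  rw [show α * (y + α) + (1 - α) * (y + α + 1) = y + 1 by ring,
    Real.Gamma_add_one (s := y + α) (by linarith [hα.1]), Real.mul_rpow (by linarith [hα.1]) hg.le] at h
  calc _ ≤ _ := h
    _ = (y + α) ^ (1 - α) * (Real.Gamma (y + α) ^ α * Real.Gamma (y + α) ^ (1 - α)) := by ring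
    _ = _ := by rw [← Real.rpow_add hg]; simp

/-- The decay `m^(-α)` feeds the ratio test for the Wright series. In the constant, `2` comes from
`α m + 1 + α ≤ 2 (m + 1)` and `1 / α` from `α (m + 1) ≤ α m + 1`. -/
theorem Gamma_ratio_le {α : ℝ} (hα : α ∈ Ioc (0 : ℝ) 1) (m : ℕ) :
    Real.Gamma (α * m + 1) / Real.Gamma (α * (m + 1 : ℕ) + 1) ≤
      2 / α * ((m : ℝ) + 1) ^ (-α) := by
  have hα0 := hα.1
  have hm : (0 : ℝ) ≤ m := Nat.cast_nonneg m
  have hy : 0 < α * m + 1 := by positivity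
  have hg := Real.Gamma_pos_of_pos (show 0 < α * m + 1 + α by linarith)
  have h := Gamma_add_one_le hα hy
  rw [show α * (m + 1 : ℕ) + 1 = α * m + 1 + α by push_cast; ring, div_le_iff₀ hg]
  have h1 : (α * m + 1 + α) ^ (1 - α) ≤ 2 * ((m : ℝ) + 1) ^ (1 - α) := by
    calc (α * m + 1 + α) ^ (1 - α) ≤ (2 * ((m : ℝ) + 1)) ^ (1 - α) := by
          refine Real.rpow_le_rpow (by positivity) ?_ (by linarith [hα.2])
          nlinarith [hα.2]
      _ = 2 ^ (1 - α) * ((m : ℝ) + 1) ^ (1 - α) := Real.mul_rpow (by norm_num) (by positivity)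
      _ ≤ 2 * ((m : ℝ) + 1) ^ (1 - α) := by
          gcongr
          calc (2 : ℝ) ^ (1 - α) ≤ 2 ^ (1 : ℝ) :=
                Real.rpow_le_rpow_of_exponent_le (by norm_num) (by linarith)
            _ = 2 := by norm_num
  have h2 : α * ((m : ℝ) + 1) ≤ α * m + 1 := by linarith [hα.2]
  have hG := Real.Gamma_pos_of_pos hy
  have h3 : α * ((m : ℝ) + 1) * Real.Gamma (α * m + 1) ≤
      2 * ((m : ℝ) + 1) ^ (1 - α) * Real.Gamma (α * m + 1 + α) :=
    (mul_le_mul_of_nonneg_right h2 hG.le).trans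
      (h.trans (mul_le_mul_of_nonneg_right h1 hg.le))
  have h4 : ((m : ℝ) + 1) ^ (1 - α) = ((m : ℝ) + 1) * ((m : ℝ) + 1) ^ (-α) := by
    rw [sub_eq_add_neg, Real.rpow_add (by positivity), Real.rpow_one]
  rw [h4] at h3
  have h5 : (0 : ℝ) < α * (m + 1) := by positivity
  rw [← mul_le_mul_iff_right₀ h5]
  calc _ ≤ _ := h3
    _ = _ := by field_simp

/-- In this form the two quotients are Mittag-Leffler moments of order `N + r`. -/
theorem wrightTerm_upper_lower (α β : ℝ) (N : ℕ) (x : ℝ) (r : ℕ) :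
    wrightTerm (wrightUpper N) (wrightLower α β N) x r =
      (((N + r).factorial : ℝ) / Real.Gamma (α * (N + r : ℕ) + 1)) *
      (((N + r).factorial : ℝ) / Real.Gamma (β * (N + r : ℕ) + 1)) * (x ^ r / r.factorial) := by
  have h : Real.Gamma (r + (N + 1)) = ((N + r).factorial : ℝ) := by
    rw [← Real.Gamma_nat_eq_factorial]
    congr 1
    push_cast
    ring
  simp only [wrightTerm, wrightUpper, wrightLower, Fin.prod_univ_two, Matrix.cons_val_zero,
    Matrix.cons_val_one, one_mul, h]
  rw [show α * (r : ℝ) + (α * N + 1) = α * (N + r : ℕ) + 1 by push_cast; ring,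
    show β * (r : ℝ) + (β * N + 1) = β * (N + r : ℕ) + 1 by push_cast; ring]
  rw [div_mul_div_comm, div_mul_div_comm, div_mul_eq_mul_div]

/-- Ratio test: the factorials contribute growth of order `r`, the Gamma functions decay of order
`r^(-(α + β))`. -/
theorem summable_wrightTerm {α β : ℝ} (hα : α ∈ Ioc (0 : ℝ) 1) (hβ : β ∈ Ioc (0 : ℝ) 1)
    (h : 1 < α + β) (N : ℕ) (x : ℝ) :
    Summable (wrightTerm (wrightUpper N) (wrightLower α β N) x) := by
  have hα0 := hα.1
  have hβ0 := hβ.1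
  -- The factor `4 / (α β)` is the product of the constants in `Gamma_ratio_le`; `N + 1` comes from
  -- `N + r + 1 ≤ (N + 1) (r + 1)`.
  set K : ℝ := 4 / (α * β) * (N + 1) * |x| with hK
  have hlim : Tendsto (fun r : ℕ => K * (((N + r : ℕ) : ℝ) + 1) ^ (1 - (α + β))) atTop (𝓝 0) := by
    rw [← mul_zero K]
    refine Tendsto.const_mul K ?_
    have h1 : Tendsto (fun y : ℝ => y ^ (-(α + β - 1))) atTop (𝓝 0) :=
      tendsto_rpow_neg_atTop (by linarith)
    rw [neg_sub] at h1
    refine h1.comp ?_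
    refine tendsto_atTop_mono (fun r : ℕ => ?_) (tendsto_natCast_atTop_atTop (R := ℝ))
    push_cast
    linarith [(Nat.cast_nonneg N : (0 : ℝ) ≤ N)]
  refine summable_of_ratio_norm_eventually_le (r := 1 / 2) (by norm_num) ?_
  filter_upwards [hlim.eventually (gt_mem_nhds (show (0 : ℝ) < 1 / 2 by norm_num))] with r hr
  set m : ℕ := N + r with hm
  rw [wrightTerm_upper_lower, wrightTerm_upper_lower, show N + (r + 1) = m + 1 by omega,
    show N + r = m from rfl]
  have hGα : 0 < Real.Gamma (α * m + 1) := Real.Gamma_pos_of_pos (by positivity)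
  have hGβ : 0 < Real.Gamma (β * m + 1) := Real.Gamma_pos_of_pos (by positivity)
  have hGα' : 0 < Real.Gamma (α * (m + 1 : ℕ) + 1) := Real.Gamma_pos_of_pos (by positivity)
  have hGβ' : 0 < Real.Gamma (β * (m + 1 : ℕ) + 1) := Real.Gamma_pos_of_pos (by positivity)
  have ha := Gamma_ratio_le hα m
  have hb := Gamma_ratio_le hβ m
  rw [div_le_iff₀ hGα'] at ha
  rw [div_le_iff₀ hGβ'] at hb
  set A := Real.Gamma (α * m + 1)
  set B := Real.Gamma (β * m + 1)
  set A' := Real.Gamma (α * (m + 1 : ℕ) + 1)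
  set B' := Real.Gamma (β * (m + 1 : ℕ) + 1)
  set u : ℝ := (m : ℝ) + 1 with hu
  have hu0 : 0 < u := by positivity
  have hur : u ≤ (N + 1) * ((r : ℝ) + 1) := by
    rw [hu, hm]; push_cast
    nlinarith [(Nat.cast_nonneg N : (0 : ℝ) ≤ N), (Nat.cast_nonneg r : (0 : ℝ) ≤ r)]
  have hab : A * B ≤ 4 / (α * β) * u ^ (-α) * u ^ (-β) * (A' * B') := by
    calc A * B ≤ (2 / α * u ^ (-α) * A') * (2 / β * u ^ (-β) * B') :=
          mul_le_mul ha hb hGβ.le (hGα.le.trans ha)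
      _ = _ := by field_simp; norm_num
  have e1 : u ^ (1 - (α + β)) = u * (u ^ (-α) * u ^ (-β)) := by
    rw [← Real.rpow_add hu0, sub_eq_add_neg, Real.rpow_add hu0, Real.rpow_one, neg_add]
  rw [e1] at hr
  have hfac : ((m + 1).factorial : ℝ) = u * m.factorial := by
    rw [Nat.factorial_succ]; push_cast; rw [hu]
  have hfac' : ((r + 1).factorial : ℝ) = ((r : ℝ) + 1) * r.factorial := by
    rw [Nat.factorial_succ]; push_cast; ring
  have hmf : (0 : ℝ) < m.factorial := by positivity
  have hrf : (0 : ℝ) < r.factorial := by positivity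
  simp only [norm_mul, norm_div, norm_pow, Real.norm_eq_abs, abs_of_pos hGα, abs_of_pos hGβ,
    abs_of_pos hGα', abs_of_pos hGβ', Nat.abs_cast]
  rw [hfac, hfac', pow_succ]
  have main : u * u * |x| * (A * B) ≤ 1 / 2 * ((r : ℝ) + 1) * (A' * B') := by
    have h0 : 0 ≤ u ^ (-α) * u ^ (-β) := by positivity
    calc u * u * |x| * (A * B) ≤ u * u * |x| * (4 / (α * β) * u ^ (-α) * u ^ (-β) * (A' * B')) := by
          gcongr
      _ = (4 / (α * β) * u * |x| * (u * (u ^ (-α) * u ^ (-β)))) * (A' * B') := by ring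
      _ ≤ (4 / (α * β) * ((N + 1) * ((r : ℝ) + 1)) * |x| * (u * (u ^ (-α) * u ^ (-β)))) *
            (A' * B') := by gcongr
      _ = (K * (u * (u ^ (-α) * u ^ (-β)))) * ((r : ℝ) + 1) * (A' * B') := by rw [hK]; ring
      _ ≤ _ := by gcongr
  have hr1 : (0 : ℝ) < r + 1 := by positivity
  calc _ = (u * u * |x| * (A * B)) * (m.factorial * m.factorial * |x| ^ r /
          (A' * B' * A * B * (((r : ℝ) + 1) * r.factorial))) := by field_simp
    _ ≤ (1 / 2 * ((r : ℝ) + 1) * (A' * B')) * (m.factorial * m.factorial * |x| ^ r /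
          (A' * B' * A * B * (((r : ℝ) + 1) * r.factorial))) := by gcongr
    _ = _ := by field_simp

theorem wrightConverges_of_one_lt {α β : ℝ} (hα : α ∈ Ioc (0 : ℝ) 1) (hβ : β ∈ Ioc (0 : ℝ) 1)
    (h : 1 < α + β) (N : ℕ) (x : ℝ) : WrightConverges (wrightUpper N) (wrightLower α β N) x :=
  (summable_wrightTerm hα hβ h N x).mono_filter (SummationFilter.LeAtTop.le_atTop)

/-! ### Mittag-Leffler laws -/

/-- The Mittag-Leffler laws: probability measures on `[0, ∞)` with moments `r! / Γ(α r + 1)`. -/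
structure IsMLLaw (α : ℝ) (ν : Measure ℝ) : Prop where
  prob : IsProbabilityMeasure ν
  nonneg : ∀ᵐ x ∂ν, 0 ≤ x
  integrable : ∀ r : ℕ, Integrable (fun x : ℝ => x ^ r) ν
  moment : ∀ r : ℕ, ∫ x, x ^ r ∂ν = (r.factorial : ℝ) / Real.Gamma (α * r + 1)

/-- This is the Wright series with `β = 1` and `N = 0`, where `α + 1 > 1` always holds. -/
theorem summable_moments_MLLaw {α : ℝ} (hα : α ∈ Ioc (0 : ℝ) 1) (v : ℝ) :
    Summable fun r : ℕ => v ^ r / (r.factorial : ℝ) *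
      ((r.factorial : ℝ) / Real.Gamma (α * r + 1)) := by
  refine (summable_wrightTerm hα (β := 1) ⟨one_pos, le_rfl⟩ (by linarith [hα.1]) 0 v).congr
    fun r => ?_
  rw [wrightTerm_upper_lower, zero_add, one_mul, Real.Gamma_nat_eq_factorial]
  field_simp

theorem IsMLLaw.ext {α : ℝ} (hα : α ∈ Ioc (0 : ℝ) 1) {ν₁ ν₂ : Measure ℝ} (h₁ : IsMLLaw α ν₁)
    (h₂ : IsMLLaw α ν₂) : ν₁ = ν₂ := by
  have := h₁.prob
  have := h₂.prob
  refine ext_of_moments h₁.nonneg h₂.nonneg h₁.integrable h₂.integrable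
    (fun r => by rw [h₁.moment, h₂.moment]) fun v _ => ?_
  simp_rw [h₁.moment]
  exact summable_moments_MLLaw hα v

theorem isMLLaw_one : IsMLLaw 1 (Measure.dirac 1) where
  prob := inferInstance
  nonneg := by rw [ae_dirac_iff measurableSet_Ici]; exact zero_le_one
  integrable r := integrable_dirac (by simp)
  moment r := by
    rw [integral_dirac, one_mul, Real.Gamma_nat_eq_factorial, one_pow, div_self (by positivity)]

/-! ### Negative moments of positive stable random variables -/

theorem integrable_and_integral_eq_of_lintegral {X : Type*} [MeasurableSpace X] {μ : Measure X}
    {f : X → ℝ} {c : ℝ} (hf : 0 ≤ᵐ[μ] f) (hm : AEStronglyMeasurable f μ) (hc : 0 ≤ c)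
    (h : ∫⁻ x, ENNReal.ofReal (f x) ∂μ = ENNReal.ofReal c) :
    Integrable f μ ∧ ∫ x, f x ∂μ = c := by
  refine ⟨⟨hm, ?_⟩, ?_⟩
  · rw [hasFiniteIntegral_iff_ofReal hf, h]
    exact ENNReal.ofReal_lt_top
  · rw [integral_eq_lintegral_of_nonneg_ae hf hm, h, ENNReal.toReal_ofReal hc]

theorem lintegral_rpow_mul_exp_neg {a y : ℝ} (ha : 0 < a) (hy : 0 < y) :
    ∫⁻ v in Ioi (0 : ℝ), ENNReal.ofReal (v ^ (a - 1) * Real.exp (-v * y)) =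
      ENNReal.ofReal (Real.Gamma a * y ^ (-a)) := by
  have h := Real.integral_rpow_mul_exp_neg_mul_Ioi ha hy
  have h0 : (1 / y) ^ a * Real.Gamma a = Real.Gamma a * y ^ (-a) := by
    rw [one_div, Real.inv_rpow hy.le, Real.rpow_neg hy.le, mul_comm]
  have e : ∀ v : ℝ, -(y * v) = -v * y := fun v => by ring
  simp_rw [e] at h
  rw [← h0, ← h, ofReal_integral_eq_lintegral_ofReal]
  -- A non-integrable function has Bochner integral `0`, so a nonzero value already gives
  -- integrability.
  · refine Integrable.of_integral_ne_zero ?_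
    rw [h]
    have := Real.Gamma_pos_of_pos ha
    positivity
  · filter_upwards [self_mem_ae_restrict measurableSet_Ioi] with v hv
    have : (0 : ℝ) < v := hv
    positivity

theorem lintegral_rpow_mul_exp_neg_rpow {α r : ℝ} (hα : 0 < α) (hr : 0 < r) :
    ∫⁻ v in Ioi (0 : ℝ), ENNReal.ofReal (v ^ (α * r - 1) * Real.exp (-v ^ α)) =
      ENNReal.ofReal (Real.Gamma r / α) := by
  have h := integral_rpow_mul_exp_neg_rpow (p := α) (q := α * r - 1) hα (by nlinarith)
  rw [sub_add_cancel, mul_div_cancel_left₀ _ hα.ne', one_div_mul_eq_div] at h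
  rw [← h, ofReal_integral_eq_lintegral_ofReal]
  · refine Integrable.of_integral_ne_zero ?_
    rw [h]
    have := Real.Gamma_pos_of_pos hr
    positivity
  · filter_upwards [self_mem_ae_restrict measurableSet_Ioi] with v hv
    have : (0 : ℝ) < v := hv
    positivity

section Stable

variable {Ω : Type*} [MeasurableSpace Ω] {μ : Measure Ω} [IsProbabilityMeasure μ] {α : ℝ}
  {S : Ω → ℝ}

theorem integrable_exp_neg_mul (hS : Measurable S) (h0 : ∀ᵐ ω ∂μ, 0 ≤ S ω) {v : ℝ} (hv : 0 ≤ v) :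
    Integrable (fun ω => Real.exp (-v * S ω)) μ := by
  refine Integrable.of_bound (by fun_prop) 1 ?_
  filter_upwards [h0] with ω hω
  rw [Real.norm_eq_abs, Real.abs_exp, Real.exp_le_one_iff]
  nlinarith

/-- An atom at `0` would keep `E exp(-v S)` away from `0` as `v → ∞`. -/
theorem ae_pos_of_laplace (hα : 0 < α) (hS : Measurable S) (h0 : ∀ᵐ ω ∂μ, 0 ≤ S ω)
    (hL : ∀ v : ℝ, 0 < v → ∫ ω, Real.exp (-v * S ω) ∂μ = Real.exp (-v ^ α)) :
    ∀ᵐ ω ∂μ, 0 < S ω := by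
  have h : ∀ n : ℕ, μ.real {ω | S ω ≤ 0} ≤ Real.exp (-((n : ℝ) + 1) ^ α) := by
    intro n
    have hn : (0 : ℝ) < (n : ℝ) + 1 := by positivity
    have h1 := mul_meas_ge_le_integral_of_nonneg (μ := μ)
      (f := fun ω => Real.exp (-((n : ℝ) + 1) * S ω)) (ae_of_all _ fun _ => (Real.exp_pos _).le)
      (integrable_exp_neg_mul hS h0 hn.le) 1
    rw [hL _ hn, one_mul] at h1
    refine le_trans (measureReal_mono fun ω hω => ?_) h1
    have : S ω ≤ 0 := hω
    rw [mem_ofPred_eq, Real.one_le_exp_iff]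
    nlinarith
  have hlim : Tendsto (fun n : ℕ => Real.exp (-((n : ℝ) + 1) ^ α)) atTop (𝓝 0) := by
    refine Real.tendsto_exp_neg_atTop_nhds_zero.comp ((tendsto_rpow_atTop hα).comp ?_)
    exact tendsto_atTop_add_const_right _ _ tendsto_natCast_atTop_atTop
  have h2 : μ.real {ω | S ω ≤ 0} = 0 :=
    le_antisymm (ge_of_tendsto' hlim h) measureReal_nonneg
  rw [measureReal_eq_zero_iff] at h2
  rw [ae_iff]
  simpa only [not_lt] using h2

/-- Tonelli for `v^(α r - 1) exp(-v S)`: integrating over `v` first gives the negative moment,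
integrating over `ω` first gives a Gamma integral. With `lintegral`, finiteness of the moment is a
conclusion rather than a premise. -/
theorem lintegral_rpow_neg_of_laplace (hα : 0 < α) (hS : Measurable S)
    (h0 : ∀ᵐ ω ∂μ, 0 ≤ S ω)
    (hL : ∀ v : ℝ, 0 < v → ∫ ω, Real.exp (-v * S ω) ∂μ = Real.exp (-v ^ α)) {r : ℝ} (hr : 0 < r) :
    ∫⁻ ω, ENNReal.ofReal (Real.Gamma (α * r) * S ω ^ (-(α * r))) ∂μ =
      ENNReal.ofReal (Real.Gamma r / α) := by
  rw [← lintegral_rpow_mul_exp_neg_rpow hα hr]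
  calc _ = ∫⁻ ω, (∫⁻ v in Ioi (0 : ℝ), ENNReal.ofReal (v ^ (α * r - 1) * Real.exp (-v * S ω))) ∂μ := by
        refine lintegral_congr_ae ?_
        filter_upwards [ae_pos_of_laplace hα hS h0 hL] with ω hω
        rw [lintegral_rpow_mul_exp_neg (by positivity) hω]
    _ = ∫⁻ v in Ioi (0 : ℝ), ∫⁻ ω, ENNReal.ofReal (v ^ (α * r - 1) * Real.exp (-v * S ω)) ∂μ := by
        refine lintegral_lintegral_swap (Measurable.aemeasurable ?_)
        dsimp only [Function.uncurry_def]
        fun_prop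
    _ = _ := by
        refine setLIntegral_congr_fun measurableSet_Ioi fun v hv => ?_
        have hv : 0 < v := hv
        have hp : 0 ≤ v ^ (α * r - 1) := by positivity
        simp only [ENNReal.ofReal_mul hp]
        rw [lintegral_const_mul _ (by fun_prop), ← ofReal_integral_eq_lintegral_ofReal
          (integrable_exp_neg_mul hS h0 hv.le) (ae_of_all _ fun _ => (Real.exp_pos _).le), hL v hv]

theorem isMLLaw_map_rpow_neg (hα : 0 < α) (hS : Measurable S)
    (h0 : ∀ᵐ ω ∂μ, 0 ≤ S ω)
    (hL : ∀ v : ℝ, 0 < v → ∫ ω, Real.exp (-v * S ω) ∂μ = Real.exp (-v ^ α)) :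
    IsMLLaw α (μ.map fun ω => S ω ^ (-α)) := by
  have hm : Measurable fun ω => S ω ^ (-α) := by fun_prop
  have key : ∀ r : ℕ, Integrable (fun ω => (S ω ^ (-α)) ^ r) μ ∧
      ∫ ω, (S ω ^ (-α)) ^ r ∂μ = (r.factorial : ℝ) / Real.Gamma (α * r + 1) := by
    intro r
    -- The Gamma integral behind the moment formula diverges at `r = 0`.
    rcases Nat.eq_zero_or_pos r with rfl | hr
    · simp
    have hr' : (0 : ℝ) < r := by exact_mod_cast hr
    have hG := Real.Gamma_pos_of_pos (show 0 < α * r by positivity)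
    have hG' := Real.Gamma_pos_of_pos hr'
    refine integrable_and_integral_eq_of_lintegral ?_ (hm.pow_const r).aestronglyMeasurable ?_ ?_
    · filter_upwards [h0] with ω hω
      positivity
    · rw [Real.Gamma_add_one (by positivity)]
      positivity
    · have h := lintegral_rpow_neg_of_laplace hα hS h0 hL hr'
      simp only [ENNReal.ofReal_mul hG.le] at h
      rw [lintegral_const_mul _ (by fun_prop)] at h
      have e : ENNReal.ofReal (Real.Gamma r / α) = ENNReal.ofReal (Real.Gamma (α * r)) *
          ENNReal.ofReal ((r.factorial : ℝ) / Real.Gamma (α * r + 1)) := by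
        rw [← ENNReal.ofReal_mul hG.le, Real.Gamma_add_one (by positivity)]
        congr 1
        rw [← Real.Gamma_nat_eq_factorial, Real.Gamma_add_one hr'.ne']
        field_simp
      rw [e, ENNReal.mul_right_inj (by simpa using hG) ENNReal.ofReal_ne_top] at h
      rw [← h]
      refine lintegral_congr_ae ?_
      filter_upwards [h0] with ω hω
      rw [← Real.rpow_natCast, ← Real.rpow_mul hω, neg_mul]
  refine ⟨Measure.isProbabilityMeasure_map hm.aemeasurable, ?_, fun r => ?_, fun r => ?_⟩
  · rw [ae_map_iff hm.aemeasurable measurableSet_Ici]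
    filter_upwards [h0] with ω hω
    positivity
  · rw [integrable_map_measure (by fun_prop) hm.aemeasurable]
    exact (key r).1
  · rw [integral_map hm.aemeasurable (by fun_prop)]
    exact (key r).2

end Stable

/-! ### The one-dimensional laws of inverse stable subordinators -/

section Inverse

variable {Ω : Type*} [MeasurableSpace Ω] {μ : Measure Ω} [IsProbabilityMeasure μ] {α : ℝ}

/-- Nonnegative random variables with the same Laplace transform at the nonnegative integers have
the same law. -/
theorem map_eq_of_laplace_nat {S T : Ω → ℝ} (hS : Measurable S) (hT : Measurable T)
    (hS0 : ∀ᵐ ω ∂μ, 0 ≤ S ω) (hT0 : ∀ᵐ ω ∂μ, 0 ≤ T ω)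
    (h : ∀ r : ℕ, 0 < r → ∫ ω, Real.exp (-(r : ℝ) * S ω) ∂μ = ∫ ω, Real.exp (-(r : ℝ) * T ω) ∂μ) :
    (μ.map fun ω => Real.exp (-S ω)) = μ.map fun ω => Real.exp (-T ω) := by
  -- The Laplace transform of `X` at `r` is the `r`-th moment of `exp(-X)`, which lies in `[0, 1]`,
  -- so determinacy by moments applies.
  have key : ∀ {X : Ω → ℝ}, Measurable X → (∀ᵐ ω ∂μ, 0 ≤ X ω) →
      (∀ᵐ x ∂(μ.map fun ω => Real.exp (-X ω)), 0 ≤ x) ∧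
      ∀ r : ℕ, Integrable (fun x : ℝ => x ^ r) (μ.map fun ω => Real.exp (-X ω)) ∧
        ∫ x, x ^ r ∂(μ.map fun ω => Real.exp (-X ω)) = ∫ ω, Real.exp (-(r : ℝ) * X ω) ∂μ ∧
        ∫ ω, Real.exp (-(r : ℝ) * X ω) ∂μ ≤ 1 := by
    intro X hX hX0
    have hm : Measurable fun ω => Real.exp (-X ω) := by fun_prop
    have hr : ∀ (r : ℕ) ω, Real.exp (-X ω) ^ r = Real.exp (-(r : ℝ) * X ω) := fun r ω => by
      rw [← Real.exp_nat_mul]; ring_nf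
    refine ⟨?_, fun r => ⟨?_, ?_, ?_⟩⟩
    · rw [ae_map_iff hm.aemeasurable measurableSet_Ici]
      exact ae_of_all _ fun _ => (Real.exp_pos _).le
    · rw [integrable_map_measure (by fun_prop) hm.aemeasurable]
      refine (integrable_exp_neg_mul hX hX0 (Nat.cast_nonneg r)).congr (ae_of_all _ fun ω => ?_)
      exact (hr r ω).symm
    · rw [integral_map hm.aemeasurable (by fun_prop)]
      simp_rw [hr]
    · calc _ ≤ ∫ _, (1 : ℝ) ∂μ := by
            refine integral_mono_ae (integrable_exp_neg_mul hX hX0 (Nat.cast_nonneg r))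
              (integrable_const 1) ?_
            filter_upwards [hX0] with ω hω
            rw [Real.exp_le_one_iff]
            nlinarith [(Nat.cast_nonneg r : (0 : ℝ) ≤ r)]
        _ = 1 := by simp
  have hmS : Measurable fun ω => Real.exp (-S ω) := by fun_prop
  have hmT : Measurable fun ω => Real.exp (-T ω) := by fun_prop
  have := Measure.isProbabilityMeasure_map (μ := μ) hmS.aemeasurable
  have := Measure.isProbabilityMeasure_map (μ := μ) hmT.aemeasurable
  obtain ⟨a1, a2⟩ := key hS hS0
  obtain ⟨b1, b2⟩ := key hT hT0
  refine ext_of_moments a1 b1 (fun r => (a2 r).1) (fun r => (b2 r).1) (fun r => ?_) fun v hv => ?_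
  · rw [(a2 r).2.1, (b2 r).2.1]
    rcases Nat.eq_zero_or_pos r with rfl | hr
    · simp
    · exact h r hr
  · refine Summable.of_nonneg_of_le (fun r => ?_) (fun r => ?_) (Real.summable_pow_div_factorial v)
    · rw [(a2 r).2.1]
      have : 0 ≤ ∫ ω, Real.exp (-(r : ℝ) * S ω) ∂μ := integral_nonneg fun _ => (Real.exp_pos _).le
      positivity
    · rw [(a2 r).2.1]
      exact mul_le_of_le_one_right (by positivity) (a2 r).2.2

variable {H : ℝ≥0 → Ω → ℝ}

theorem IsStableSubordinator.ae_nonneg {Ω : Type*} [MeasurableSpace Ω] {μ : Measure Ω} {α : ℝ}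
    {H : ℝ≥0 → Ω → ℝ} (h : IsStableSubordinator α H μ) :
    ∀ᵐ ω ∂μ, ∀ x, 0 ≤ H x ω := by
  filter_upwards [h.mono, h.levy.start] with ω h1 h2 x
  rw [← h2]
  exact h1 (zero_le (a := x))

/-- Self-similarity: both variables have Laplace transform `exp(-x v^α)`. -/
theorem IsStableSubordinator.map_exp_eq (h : IsStableSubordinator α H μ) (x : ℝ≥0) :
    (μ.map fun ω => Real.exp (-H x ω)) =
      μ.map fun ω => Real.exp (-((x : ℝ) ^ (1 / α) * H 1 ω)) := by
  have hα := h.index.1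
  have h1 := h.levy.meas 1
  refine map_eq_of_laplace_nat (h.levy.meas x) (by fun_prop) ?_ ?_ fun r hr => ?_
  · filter_upwards [h.ae_nonneg] with ω hω using hω x
  · filter_upwards [h.ae_nonneg] with ω hω
    have := hω 1
    positivity
  have hr' : (0 : ℝ) < r := by exact_mod_cast hr
  rw [h.laplace x r hr']
  rcases eq_or_ne x 0 with rfl | hx
  · simp [Real.zero_rpow (inv_pos.mpr hα).ne']
  have hx' : (0 : ℝ) < x := by exact_mod_cast pos_iff_ne_zero.mpr hx
  have := h.laplace 1 (r * (x : ℝ) ^ (1 / α)) (by positivity)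
  rw [Real.mul_rpow hr'.le (by positivity), ← Real.rpow_mul hx'.le, one_div_mul_cancel hα.ne',
    Real.rpow_one] at this
  rw [show -(x : ℝ) * (r : ℝ) ^ α = -((1 : ℝ≥0) : ℝ) * ((r : ℝ) ^ α * x) by
    push_cast; ring, ← this]
  congr 1
  ext ω
  ring_nf

/-- Markov's inequality bounds the probability of staying below `N` up to time `n` by `exp(N - n)`.
This rules out the default value `sInf ∅ = 0` in the hitting time. -/
theorem IsStableSubordinator.ae_unbounded (h : IsStableSubordinator α H μ) :
    ∀ᵐ ω ∂μ, ∀ s : ℝ, ∃ x, s ≤ H x ω := by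
  have key : ∀ N : ℕ, ∀ᵐ ω ∂μ, ∃ x, (N : ℝ) ≤ H x ω := by
    intro N
    have h1 : ∀ n : ℕ, μ.real {ω | ¬ ∃ x, (N : ℝ) ≤ H x ω} ≤
        Real.exp N * Real.exp (-(n : ℝ)) := by
      intro n
      have h2 := mul_meas_ge_le_integral_of_nonneg (μ := μ)
        (f := fun ω => Real.exp (-(1 : ℝ) * H n ω)) (ae_of_all _ fun _ => (Real.exp_pos _).le)
        (integrable_exp_neg_mul (h.levy.meas n) (by
          filter_upwards [h.ae_nonneg] with ω hω using hω n) zero_le_one) (Real.exp (-N))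
      rw [h.laplace n 1 one_pos, Real.one_rpow, mul_one, NNReal.coe_natCast] at h2
      calc _ ≤ μ.real {ω | Real.exp (-N) ≤ Real.exp (-(1 : ℝ) * H n ω)} := by
            refine measureReal_mono fun ω hω => ?_
            simp only [mem_ofPred_eq, not_exists, not_le] at hω ⊢
            rw [Real.exp_le_exp]
            linarith [hω n]
        _ = Real.exp N * (Real.exp (-N) * μ.real {ω | Real.exp (-N) ≤
              Real.exp (-(1 : ℝ) * H n ω)}) := by
            rw [← mul_assoc, ← Real.exp_add, add_neg_cancel, Real.exp_zero, one_mul]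
        _ ≤ _ := by gcongr
    have hlim : Tendsto (fun n : ℕ => Real.exp N * Real.exp (-(n : ℝ))) atTop (𝓝 0) := by
      rw [← mul_zero (Real.exp N)]
      exact (Real.tendsto_exp_neg_atTop_nhds_zero.comp tendsto_natCast_atTop_atTop).const_mul _
    have h2 := le_antisymm (ge_of_tendsto' hlim h1) measureReal_nonneg
    rw [measureReal_eq_zero_iff] at h2
    exact h2
  filter_upwards [ae_all_iff.mpr key] with ω hω s
  obtain ⟨N, hN⟩ := exists_nat_ge s
  obtain ⟨x, hx⟩ := hω N
  exact ⟨x, hN.trans hx⟩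

/-- By monotonicity and right-continuity, the nonempty set of times at which the path is at least
`s` contains its infimum and everything above it. -/
theorem IsStableSubordinator.ae_sInf_le_iff (h : IsStableSubordinator α H μ) (s : ℝ) :
    ∀ᵐ ω ∂μ, ∀ x : ℝ≥0, sInf {y : ℝ≥0 | s ≤ H y ω} ≤ x ↔ s ≤ H x ω := by
  filter_upwards [h.mono, h.levy.cadlag, h.ae_unbounded] with ω h1 h2 h3 x
  refine ⟨fun hx => ?_, fun hx => csInf_le (OrderBot.bddBelow _) hx⟩
  have hc : Tendsto (fun y => H y ω) (𝓝[>] x) (𝓝 (H x ω)) :=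
    (h2 x).1.mono_left (nhdsWithin_mono _ Ioi_subset_Ici_self)
  refine ge_of_tendsto hc ?_
  filter_upwards [self_mem_nhdsWithin] with y hy
  obtain ⟨z, hz, hzy⟩ := exists_lt_of_csInf_lt (h3 s) (lt_of_le_of_lt hx hy)
  exact le_trans hz (h1 hzy.le)

/-- The one-dimensional laws of an inverse stable subordinator are scaled Mittag-Leffler laws. -/
theorem IsInverseStableSubordinator.exists_law {L : ℝ≥0 → Ω → ℝ≥0}
    (h : IsInverseStableSubordinator α L μ) :
    ∃ ν, IsMLLaw α ν ∧ ∀ s : ℝ≥0, AEMeasurable (L s) μ ∧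
      (μ.map fun ω => (L s ω : ℝ)) = ν.map fun x => (s : ℝ) ^ α * x := by
  rcases h with ⟨H, hH, hL⟩ | ⟨rfl, hL⟩
  swap
  · refine ⟨_, isMLLaw_one, fun s => ⟨⟨fun _ => s, measurable_const, hL s⟩, ?_⟩⟩
    have : (fun ω => (L s ω : ℝ)) =ᵐ[μ] fun _ => (s : ℝ) := by
      filter_upwards [hL s] with ω hω
      rw [hω]
    rw [Measure.map_congr this, Measure.map_const,
      Measure.map_dirac' (by fun_prop)]
    simp
  have hα := hH.index.1
  have hS := hH.levy.meas 1
  have hS0 : ∀ᵐ ω ∂μ, 0 ≤ H 1 ω := by filter_upwards [hH.ae_nonneg] with ω hω using hω 1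
  have hLap : ∀ v : ℝ, 0 < v → ∫ ω, Real.exp (-v * H 1 ω) ∂μ = Real.exp (-v ^ α) := by
    intro v hv
    rw [hH.laplace 1 v hv]
    simp
  have hpos := ae_pos_of_laplace hα hS hS0 hLap
  refine ⟨_, isMLLaw_map_rpow_neg hα hS hS0 hLap, fun s => ?_⟩
  have hiff : ∀ᵐ ω ∂μ, ∀ x : ℝ≥0, L s ω ≤ x ↔ (s : ℝ) ≤ H x ω := by
    simp_rw [hL]
    exact hH.ae_sInf_le_iff s
  have hset : ∀ x : ℝ≥0, {ω | L s ω ≤ x} =ᵐ[μ] {ω | (s : ℝ) ≤ H x ω} := by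
    intro x
    filter_upwards [hiff] with ω hω
    exact propext (hω x)
  have hmeas : AEMeasurable (L s) μ := by
    -- The events `L s ≤ x` agree with measurable events only up to null sets, so measurability is
    -- checked in the completed σ-algebra.
    have h1 : @Measurable (NullMeasurableSpace Ω μ) ℝ≥0 _ _ (L s) := by
      refine measurable_of_Iic fun x => ?_
      have h2 : NullMeasurableSet {ω | (s : ℝ) ≤ H x ω} μ :=
        (measurableSet_le measurable_const (hH.levy.meas x)).nullMeasurableSet
      exact h2.congr (hset x).symm
    have h3 : NullMeasurable (L s) μ := fun t ht => h1 ht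
    exact h3.aemeasurable
  refine ⟨hmeas, ?_⟩
  have hm2 : Measurable fun ω => H 1 ω ^ (-α) := by fun_prop
  rw [Measure.map_map (by fun_prop) hm2]
  have hmL : AEMeasurable (fun ω => (L s ω : ℝ)) μ :=
    measurable_coe_nnreal_real.comp_aemeasurable hmeas
  have hmR : Measurable ((fun x => (s : ℝ) ^ α * x) ∘ fun ω => H 1 ω ^ (-α)) := by fun_prop
  have := Measure.isProbabilityMeasure_map hmL
  refine Measure.ext_of_Iic _ _ fun a => ?_
  rw [Measure.map_apply_of_aemeasurable hmL measurableSet_Iic, Measure.map_apply hmR measurableSet_Iic]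
  rcases lt_or_ge a 0 with ha | ha
  · have e1 : (fun ω => (L s ω : ℝ)) ⁻¹' Iic a = ∅ := by
      ext ω
      simp only [mem_preimage, mem_Iic, mem_empty_iff_false, iff_false, not_le]
      exact ha.trans_le (L s ω).2
    have e2 : ((fun x => (s : ℝ) ^ α * x) ∘ fun ω => H 1 ω ^ (-α)) ⁻¹' Iic a =ᵐ[μ] (∅ : Set Ω) := by
      filter_upwards [hS0] with ω hω
      refine propext ⟨fun hx => ?_, fun hx => hx.elim⟩
      have h5 : (s : ℝ) ^ α * H 1 ω ^ (-α) ≤ a := hx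
      have : 0 ≤ (s : ℝ) ^ α * H 1 ω ^ (-α) := by positivity
      linarith
    rw [e1, measure_congr e2]
  lift a to ℝ≥0 using ha
  have e1 : (fun ω => (L s ω : ℝ)) ⁻¹' Iic (a : ℝ) = {ω | L s ω ≤ a} := by
    ext ω
    simp
  rw [e1, measure_congr (hset a)]
  -- Since `exp(-·)` reverses order, equality of the laws of the exponentials is enough.
  have e2 : μ {ω | (s : ℝ) ≤ H a ω} = μ {ω | (s : ℝ) ≤ (a : ℝ) ^ (1 / α) * H 1 ω} := by
    have hHa := hH.levy.meas a
    have h6 := congrArg (fun m => m (Iic (Real.exp (-s)))) (hH.map_exp_eq a)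
    rw [Measure.map_apply (by fun_prop) measurableSet_Iic,
      Measure.map_apply (by fun_prop) measurableSet_Iic] at h6
    simpa [Set.preimage, Real.exp_le_exp] using h6
  rw [e2]
  refine measure_congr ?_
  filter_upwards [hpos] with ω hω
  refine propext ?_
  change (s : ℝ) ≤ (a : ℝ) ^ (1 / α) * H 1 ω ↔ (s : ℝ) ^ α * H 1 ω ^ (-α) ≤ a
  have hp : 0 < H 1 ω ^ α := by positivity
  rw [Real.rpow_neg hω.le, ← div_eq_mul_inv, div_le_iff₀ hp,
    ← Real.rpow_le_rpow_iff s.coe_nonneg (mul_nonneg (Real.rpow_nonneg a.coe_nonneg _) hω.le) hα,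
    Real.mul_rpow (by positivity) hω.le, ← Real.rpow_mul a.coe_nonneg, one_div_mul_cancel hα.ne',
    Real.rpow_one]

end Inverse

/-! ### The Caputo derivative of a Mittag-Leffler mixture -/

theorem lintegral_beta_scaled {a b s : ℝ} (ha : 0 < a) (hb : 0 < b) (hs : 0 < s) :
    ∫⁻ τ in Ioo 0 s, ENNReal.ofReal (τ ^ (a - 1) * (s - τ) ^ (b - 1)) =
      ENNReal.ofReal (s ^ (a + b - 1) * (Real.Gamma a * Real.Gamma b / Real.Gamma (a + b))) := by
  have hpos : 0 < s ^ (a + b - 1) * (Real.Gamma a * Real.Gamma b / Real.Gamma (a + b)) := by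
    have h1 := Real.Gamma_pos_of_pos ha
    have h2 := Real.Gamma_pos_of_pos hb
    have h3 := Real.Gamma_pos_of_pos (add_pos ha hb)
    positivity
  have h : ∫ τ in Ioo 0 s, τ ^ (a - 1) * (s - τ) ^ (b - 1) =
      s ^ (a + b - 1) * (Real.Gamma a * Real.Gamma b / Real.Gamma (a + b)) := by
    have h1 := Complex.betaIntegral_scaled (a : ℂ) (b : ℂ) hs
    rw [Complex.betaIntegral_eq_Gamma_mul_div _ _ (by simpa) (by simpa),
      intervalIntegral.integral_of_le hs.le, integral_Ioc_eq_integral_Ioo] at h1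
    have h2 : ∫ τ in Ioo 0 s, ((τ : ℂ) ^ ((a : ℂ) - 1) * ((s : ℂ) - τ) ^ ((b : ℂ) - 1)) =
        ∫ τ in Ioo 0 s, ((τ ^ (a - 1) * (s - τ) ^ (b - 1) : ℝ) : ℂ) := by
      refine setIntegral_congr_fun measurableSet_Ioo fun τ hτ => ?_
      simp only [Complex.ofReal_mul]
      rw [Complex.ofReal_cpow hτ.1.le, Complex.ofReal_cpow (sub_nonneg.mpr hτ.2.le)]
      push_cast
      rfl
    rw [h2, integral_complex_ofReal] at h1
    have h3 : (s : ℂ) ^ ((a : ℂ) + b - 1) * (Complex.Gamma a * Complex.Gamma b /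
        Complex.Gamma (a + b)) =
        ((s ^ (a + b - 1) * (Real.Gamma a * Real.Gamma b / Real.Gamma (a + b)) : ℝ) : ℂ) := by
      rw [← Complex.ofReal_add, Complex.Gamma_ofReal, Complex.Gamma_ofReal, Complex.Gamma_ofReal]
      push_cast
      rw [Complex.ofReal_cpow hs.le]
      push_cast
      rfl
    rw [h3] at h1
    exact_mod_cast h1
  rw [← h, ofReal_integral_eq_lintegral_ofReal]
  · refine Integrable.of_integral_ne_zero ?_
    rw [h]
    exact hpos.ne'
  · filter_upwards [self_mem_ae_restrict measurableSet_Ioo] with τ hτ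
    have h1 := hτ.1
    have h2 := sub_pos.mpr hτ.2
    positivity

/-- The density of the mixture in `IsMLLaw.map_mix`. -/
noncomputable def mixWeight (α s : ℝ) (p : ℝ × ℝ) : ℝ :=
  α / Real.Gamma (1 - α) * (p.1 ^ (α - 1) * (s - p.1) ^ (-α) * p.2)

@[fun_prop]
theorem measurable_mixWeight (α s : ℝ) : Measurable (mixWeight α s) := by
  unfold mixWeight
  fun_prop

section Mix

variable {α s : ℝ} {ν : Measure ℝ}

theorem IsMLLaw.ae_mem (hν : IsMLLaw α ν) (s : ℝ) :
    ∀ᵐ p ∂((volume.restrict (Ioo 0 s)).prod ν), p.1 ∈ Ioo 0 s ∧ 0 ≤ p.2 := by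
  have := hν.prob
  exact (Measure.quasiMeasurePreserving_fst.ae (self_mem_ae_restrict measurableSet_Ioo)).and
    (Measure.quasiMeasurePreserving_snd.ae hν.nonneg)

theorem mixWeight_nonneg (hα : α ∈ Ioo (0 : ℝ) 1) {p : ℝ × ℝ} (hp : p.1 ∈ Ioo 0 s ∧ 0 ≤ p.2) :
    0 ≤ mixWeight α s p := by
  have h1 := Real.Gamma_pos_of_pos (sub_pos.mpr hα.2)
  have h2 := hp.1.1
  have h3 := sub_pos.mpr hp.1.2
  have h4 := hp.2
  have h5 := hα.1
  unfold mixWeight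
  positivity

theorem IsMLLaw.lintegral_pow (hν : IsMLLaw α ν) (r : ℕ) :
    ∫⁻ x, ENNReal.ofReal (x ^ r) ∂ν =
      ENNReal.ofReal ((r.factorial : ℝ) / Real.Gamma (α * r + 1)) := by
  rw [← hν.moment, ofReal_integral_eq_lintegral_ofReal (hν.integrable r)]
  filter_upwards [hν.nonneg] with x hx
  positivity

/-- The integrand factors into a Beta integral with parameters `α r + α`, `1 - α` and the moment of
order `r + 1`. The identity `Γ(α (r + 1) + 1) = α (r + 1) Γ(α r + α)` then lowers this to the moment
of order `r`. -/
theorem IsMLLaw.lintegral_mix (hα : α ∈ Ioo (0 : ℝ) 1) (hν : IsMLLaw α ν) (hs : 0 < s) (r : ℕ) :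
    ∫⁻ p, ENNReal.ofReal (mixWeight α s p) * ENNReal.ofReal ((p.1 ^ α * p.2) ^ r)
      ∂((volume.restrict (Ioo 0 s)).prod ν) =
      ENNReal.ofReal ((s ^ α) ^ r * ((r.factorial : ℝ) / Real.Gamma (α * r + 1))) := by
  have := hν.prob
  have hα0 := hα.1
  have hG := Real.Gamma_pos_of_pos (sub_pos.mpr hα.2)
  calc _ = ∫⁻ p, (ENNReal.ofReal (α / Real.Gamma (1 - α)) *
        ENNReal.ofReal (p.1 ^ (α * r + α - 1) * (s - p.1) ^ ((1 - α) - 1))) *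
          ENNReal.ofReal (p.2 ^ (r + 1)) ∂((volume.restrict (Ioo 0 s)).prod ν) := by
        refine lintegral_congr_ae ?_
        filter_upwards [hν.ae_mem s] with p hp
        have h2 := hp.1.1
        have h3 := sub_pos.mpr hp.1.2
        have h4 := hp.2
        rw [← ENNReal.ofReal_mul (mixWeight_nonneg hα hp), ← ENNReal.ofReal_mul (by positivity),
          ← ENNReal.ofReal_mul (by positivity)]
        congr 1
        rw [mixWeight, add_sub_assoc, Real.rpow_add h2, Real.rpow_mul h2.le, Real.rpow_natCast,
          mul_pow, pow_succ, sub_sub_cancel_left]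
        ring
    _ = _ := by
        rw [lintegral_prod_mul (f := fun τ : ℝ => ENNReal.ofReal (α / Real.Gamma (1 - α)) *
          ENNReal.ofReal (τ ^ (α * r + α - 1) * (s - τ) ^ ((1 - α) - 1)))
          (g := fun x : ℝ => ENNReal.ofReal (x ^ (r + 1))) (by fun_prop) (by fun_prop),
          lintegral_const_mul _ (by fun_prop),
          lintegral_beta_scaled (by positivity) (sub_pos.mpr hα.2) hs, hν.lintegral_pow,
          ← ENNReal.ofReal_mul (by positivity)]
        have e : α * r + α + (1 - α) = α * r + 1 := by ring
        have e2 : α * ((r + 1 : ℕ) : ℝ) + 1 = (α * r + α) + 1 := by push_cast; ring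
        have hg1 := Real.Gamma_pos_of_pos (show 0 < α * r + α by positivity)
        have hg2 := Real.Gamma_pos_of_pos (show 0 < α * r + 1 by positivity)
        rw [e, e2, Real.Gamma_add_one (s := α * r + α) (by positivity), ← ENNReal.ofReal_mul (by positivity)]
        congr 1
        rw [add_sub_cancel_right, Real.rpow_mul hs.le, Real.rpow_natCast, Nat.factorial_succ]
        push_cast
        field_simp

/-- The fractional beta mixture of a Mittag-Leffler law reproduces the scaled law. -/
theorem IsMLLaw.map_mix (hα : α ∈ Ioo (0 : ℝ) 1) (hν : IsMLLaw α ν) (hs : 0 < s) :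
    ((((volume.restrict (Ioo 0 s)).prod ν).withDensity fun p =>
      ENNReal.ofReal (mixWeight α s p)).map fun p => p.1 ^ α * p.2) =
      ν.map fun x => s ^ α * x := by
  have := hν.prob
  have hα0 := hα.1
  have hm : Measurable fun p : ℝ × ℝ => p.1 ^ α * p.2 := by fun_prop
  have hms : Measurable fun x : ℝ => s ^ α * x := by fun_prop
  have hsα : 0 ≤ s ^ α := by positivity
  set κ := (((volume.restrict (Ioo 0 s)).prod ν).withDensity fun p =>
      ENNReal.ofReal (mixWeight α s p)).map fun p => p.1 ^ α * p.2 with hκ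
  have hlin : ∀ r : ℕ, ∫⁻ x, ENNReal.ofReal (x ^ r) ∂κ =
      ENNReal.ofReal ((s ^ α) ^ r * ((r.factorial : ℝ) / Real.Gamma (α * r + 1))) := by
    intro r
    rw [hκ, lintegral_map (by fun_prop) hm, lintegral_withDensity_eq_lintegral_mul _ (by fun_prop)
      (by fun_prop), ← hν.lintegral_mix hα hs r]
    rfl
  have hfin : IsFiniteMeasure κ := by
    refine ⟨?_⟩
    have := hlin 0
    simp only [pow_zero, ENNReal.ofReal_one, lintegral_const, one_mul] at this
    rw [this]
    exact ENNReal.ofReal_lt_top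
  have hκ0 : ∀ᵐ x ∂κ, 0 ≤ x := by
    rw [hκ, ae_map_iff hm.aemeasurable measurableSet_Ici]
    refine (withDensity_absolutelyContinuous _ _).ae_le ?_
    filter_upwards [hν.ae_mem s] with p hp
    have h2 := hp.1.1
    have h4 := hp.2
    change 0 ≤ p.1 ^ α * p.2
    positivity
  have hmom : ∀ r : ℕ, Integrable (fun x : ℝ => x ^ r) κ ∧
      ∫ x, x ^ r ∂κ = (s ^ α) ^ r * ((r.factorial : ℝ) / Real.Gamma (α * r + 1)) := by
    intro r
    refine integrable_and_integral_eq_of_lintegral ?_ (by fun_prop) ?_ (hlin r)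
    · filter_upwards [hκ0] with x hx
      positivity
    · have := Real.Gamma_pos_of_pos (show 0 < α * r + 1 by positivity)
      positivity
  refine ext_of_moments hκ0 ?_ (fun r => (hmom r).1) (fun r => ?_) (fun r => ?_) fun v _ => ?_
  · rw [ae_map_iff hms.aemeasurable measurableSet_Ici]
    filter_upwards [hν.nonneg] with x hx
    exact mul_nonneg hsα hx
  · rw [integrable_map_measure (by fun_prop) hms.aemeasurable]
    simp only [Function.comp_def, mul_pow]
    exact (hν.integrable r).const_mul _
  · rw [(hmom r).2, integral_map hms.aemeasurable (by fun_prop)]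
    simp only [mul_pow]
    rw [integral_const_mul, hν.moment]
  · refine (summable_moments_MLLaw ⟨hα.1, hα.2.le⟩ (v * s ^ α)).congr fun r => ?_
    rw [(hmom r).2, mul_pow]
    ring

/-- The identity of laws in `IsMLLaw.map_mix`, tested against `h`; in the Caputo derivative `h` is
`f'`. -/
theorem IsMLLaw.integral_mix (hα : α ∈ Ioo (0 : ℝ) 1) (hν : IsMLLaw α ν) (hs : 0 < s)
    {h : ℝ → ℝ} (hh : Measurable h) (hi : Integrable (fun x => h (s ^ α * x)) ν) :
    Integrable (fun p => mixWeight α s p * h (p.1 ^ α * p.2))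
      ((volume.restrict (Ioo 0 s)).prod ν) ∧
    ∫ p, mixWeight α s p * h (p.1 ^ α * p.2) ∂((volume.restrict (Ioo 0 s)).prod ν) =
      ∫ x, h (s ^ α * x) ∂ν := by
  have := hν.prob
  have hm : Measurable fun p : ℝ × ℝ => p.1 ^ α * p.2 := by fun_prop
  have hms : Measurable fun x : ℝ => s ^ α * x := by fun_prop
  have hw : Measurable fun p => ENNReal.ofReal (mixWeight α s p) := by fun_prop
  have hlt : ∀ᵐ p ∂((volume.restrict (Ioo 0 s)).prod ν),
      ENNReal.ofReal (mixWeight α s p) < ⊤ := ae_of_all _ fun _ => ENNReal.ofReal_lt_top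
  have hcongr : (fun p => (ENNReal.ofReal (mixWeight α s p)).toReal • h (p.1 ^ α * p.2))
      =ᵐ[(volume.restrict (Ioo 0 s)).prod ν] fun p => mixWeight α s p * h (p.1 ^ α * p.2) := by
    filter_upwards [hν.ae_mem s] with p hp
    rw [ENNReal.toReal_ofReal (mixWeight_nonneg hα hp), smul_eq_mul]
  have key := hν.map_mix hα hs
  constructor
  · have h1 : Integrable h (ν.map fun x => s ^ α * x) :=
      (integrable_map_measure hh.aestronglyMeasurable hms.aemeasurable).mpr hi
    rw [← key, integrable_map_measure hh.aestronglyMeasurable hm.aemeasurable,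
      integrable_withDensity_iff_integrable_smul' hw hlt] at h1
    exact h1.congr hcongr
  · rw [← integral_map hms.aemeasurable hh.aestronglyMeasurable (f := h), ← key,
      integral_map hm.aemeasurable hh.aestronglyMeasurable,
      integral_withDensity_eq_integral_toReal_smul hw hlt]
    exact integral_congr_ae hcongr.symm

theorem IsMLLaw.integrable_of_le (hν : IsMLLaw α ν) {g : ℝ → ℝ} (hg : Measurable g) {C : ℝ}
    {r : ℕ} (hC : ∀ x, 0 ≤ x → |g x| ≤ C * (1 + x) ^ r) : Integrable g ν := by
  have := hν.prob
  have h1 : Integrable (fun x : ℝ => C * (1 + x) ^ r) ν := by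
    refine Integrable.const_mul ?_ C
    simp_rw [add_comm (1 : ℝ), add_pow]
    refine integrable_finsetSum _ fun i _ => ?_
    exact ((hν.integrable i).mul_const _).mul_const _
  refine h1.mono' hg.aestronglyMeasurable ?_
  filter_upwards [hν.nonneg] with x hx using hC x hx

theorem IsMLLaw.integrable_comp_of_le (hν : IsMLLaw α ν) {g : ℝ → ℝ} (hg : Measurable g) {C : ℝ}
    (hC : ∀ x, 0 ≤ x → |g x| ≤ C * (1 + x)) {c : ℝ} (hc : 0 ≤ c) :
    Integrable (fun x => g (c * x)) ν := by
  have hC0 : 0 ≤ C := by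
    have := (abs_nonneg _).trans (hC 0 le_rfl)
    simpa using this
  refine hν.integrable_of_le (C := C * (1 + c)) (r := 1) (by fun_prop) fun x hx => ?_
  refine (hC _ (mul_nonneg hc hx)).trans ?_
  rw [pow_one, mul_assoc]
  refine mul_le_mul_of_nonneg_left ?_ hC0
  nlinarith

/-- Linear growth is allowed because the second Caputo derivative meets a function `z ↦ z * g z`.
The exponent `α` is separate from the index `γ`, so that exponent `1` covers plain dilations. Near
`s` and away from `0`, the powers of `σ` are bounded and the dominating function is quadratic in
`x`. -/
theorem IsMLLaw.hasDerivAt_mix {γ : ℝ} (hα : α ∈ Ioc (0 : ℝ) 1) (hν : IsMLLaw γ ν) {f f' : ℝ → ℝ}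
    (hf : Measurable f) (hf' : Measurable f') {C : ℝ} (hC : ∀ x, 0 ≤ x → |f x| ≤ C * (1 + x))
    (hC' : ∀ x, 0 ≤ x → |f' x| ≤ C * (1 + x)) (hd : ∀ x, 0 < x → HasDerivAt f (f' x) x)
    (hs : 0 < s) :
    HasDerivAt (fun σ => ∫ x, f (σ ^ α * x) ∂ν)
      (∫ x, f' (s ^ α * x) * (α * s ^ (α - 1) * x) ∂ν) s := by
  have hα0 := hα.1
  have hC0 : 0 ≤ C := by
    have := (abs_nonneg _).trans (hC 0 le_rfl)
    simpa using this
  refine (hasDerivAt_integral_of_dominated_loc_of_deriv_le (μ := ν) (s := Ioo (s / 2) (2 * s))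
    (F := fun σ x => f (σ ^ α * x)) (F' := fun σ x => f' (σ ^ α * x) * (α * σ ^ (α - 1) * x))
    (bound := fun x => C * (1 + (2 * s) ^ α * x) * (α * (s / 2) ^ (α - 1) * x))
    (Ioo_mem_nhds (by linarith) (by linarith)) ?_ ?_ ?_ ?_ ?_ ?_).2
  · exact Eventually.of_forall fun σ => (by fun_prop : Measurable _).aestronglyMeasurable
  · exact hν.integrable_comp_of_le hf hC (by positivity)
  · exact (by fun_prop : Measurable _).aestronglyMeasurable
  · filter_upwards [hν.nonneg] with x hx σ hσ
    have hσ0 : 0 < σ := by linarith [hσ.1]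
    rw [Real.norm_eq_abs, abs_mul]
    refine mul_le_mul ?_ ?_ (abs_nonneg _) (by positivity)
    · refine (hC' _ (by positivity)).trans ?_
      have : σ ^ α ≤ (2 * s) ^ α := Real.rpow_le_rpow hσ0.le hσ.2.le hα0.le
      gcongr
    · rw [abs_of_nonneg (by positivity)]
      have : σ ^ (α - 1) ≤ (s / 2) ^ (α - 1) :=
        Real.rpow_le_rpow_of_nonpos (by positivity) hσ.1.le (by linarith [hα.2])
      gcongr
  · have h1 := (hν.integrable 1).const_mul (C * (α * (s / 2) ^ (α - 1)))
    have h2 := (hν.integrable 2).const_mul (C * (2 * s) ^ α * (α * (s / 2) ^ (α - 1)))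
    refine (h1.add h2).congr (ae_of_all _ fun x => ?_)
    simp only [Pi.add_apply]
    ring
  · filter_upwards [hν.nonneg] with x hx σ hσ
    have hσ0 : 0 < σ := by linarith [hσ.1]
    have h1 : HasDerivAt (fun σ : ℝ => σ ^ α * x) (α * σ ^ (α - 1) * x) σ :=
      (Real.hasDerivAt_rpow_const (Or.inl hσ0.ne')).mul_const x
    -- At `x = 0` the integrand does not depend on `σ`; `hd` covers positive points only.
    rcases hx.eq_or_lt with rfl | hx
    · simpa using hasDerivAt_const σ (f 0)
    · exact (hd _ (by positivity)).comp σ h1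

/-- The Caputo derivative of `s ↦ E f(s^α ξ)` is `s ↦ E f'(s^α ξ)` for a Mittag-Leffler
variable `ξ`. -/
theorem IsMLLaw.caputo (hα : α ∈ Ioc (0 : ℝ) 1) (hν : IsMLLaw α ν) {f f' F : ℝ → ℝ}
    (hf : Measurable f) (hf' : Measurable f') {C : ℝ} (hC : ∀ x, 0 ≤ x → |f x| ≤ C * (1 + x))
    (hC' : ∀ x, 0 ≤ x → |f' x| ≤ C * (1 + x)) (hd : ∀ x, 0 < x → HasDerivAt f (f' x) x)
    (hF : ∀ σ, 0 < σ → F σ = ∫ x, f (σ ^ α * x) ∂ν) (hs : 0 < s) :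
    CaputoDifferentiableAt α F s ∧ caputoDeriv α F s = ∫ x, f' (s ^ α * x) ∂ν := by
  have hD : ∀ τ, 0 < τ → HasDerivAt F (∫ x, f' (τ ^ α * x) * (α * τ ^ (α - 1) * x) ∂ν) τ := by
    intro τ hτ
    refine (hν.hasDerivAt_mix hα hf hf' hC hC' hd hτ).congr_of_eventuallyEq ?_
    filter_upwards [lt_mem_nhds hτ] with σ hσ using hF σ hσ
  unfold CaputoDifferentiableAt caputoDeriv
  split_ifs with h1
  -- For `α = 1` the law is the point mass at `1`, and both sides are `f' s`.
  · refine ⟨(hD s hs).differentiableAt, ?_⟩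
    subst h1
    rw [(hD s hs).deriv, hν.ext hα isMLLaw_one, integral_dirac, integral_dirac]
    simp
  have := hν.prob
  have hα' : α ∈ Ioo (0 : ℝ) 1 := ⟨hα.1, lt_of_le_of_ne hα.2 h1⟩
  have hG := Real.Gamma_pos_of_pos (sub_pos.mpr hα'.2)
  obtain ⟨i1, i2⟩ := hν.integral_mix hα' hs hf'
    (hν.integrable_comp_of_le hf' hC' (Real.rpow_nonneg hs.le _))
  -- The chain-rule factor `α τ^(α-1) x` times the Caputo kernel is exactly `mixWeight`; Fubini and
  -- `integral_mix` finish.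
  have hpt : ∀ τ ∈ Ioo 0 s, ∫ x, mixWeight α s (τ, x) * f' (τ ^ α * x) ∂ν =
      1 / Real.Gamma (1 - α) * (deriv F τ / (s - τ) ^ α) := by
    intro τ hτ
    rw [(hD τ hτ.1).deriv, div_eq_mul_inv _ ((s - τ) ^ α),
      ← Real.rpow_neg (sub_nonneg.mpr hτ.2.le), ← mul_assoc, mul_comm, ← mul_assoc,
      ← integral_const_mul]
    refine integral_congr_ae (ae_of_all _ fun x => ?_)
    simp only [mixWeight]
    ring
  refine ⟨⟨fun τ hτ => (hD τ hτ.1).differentiableAt, ?_⟩, ?_⟩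
  · rw [intervalIntegrable_iff_integrableOn_Ioo_of_le hs.le]
    have h2 := (i1.integral_prod_left).const_mul (Real.Gamma (1 - α))
    refine h2.congr ?_
    filter_upwards [self_mem_ae_restrict measurableSet_Ioo] with τ hτ
    rw [hpt τ hτ]
    field_simp
  · rw [← i2, integral_prod _ i1, intervalIntegral.integral_of_le hs.le,
      integral_Ioc_eq_integral_Ioo, ← integral_const_mul]
    exact setIntegral_congr_fun measurableSet_Ioo fun τ hτ => (hpt τ hτ).symm

end Mix

/-! ### The law of the number of points -/

theorem hasDerivAt_poissonWeight (m : ℕ) (y : ℝ) :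
    HasDerivAt (fun y : ℝ => y ^ m / (m.factorial : ℝ) * Real.exp (-y))
      ((if m = 0 then 0 else y ^ (m - 1) / ((m - 1).factorial : ℝ) * Real.exp (-y)) -
        y ^ m / (m.factorial : ℝ) * Real.exp (-y)) y := by
  have h1 : HasDerivAt (fun y : ℝ => Real.exp (-y)) (-Real.exp (-y)) y := by
    simpa using (hasDerivAt_neg y).exp
  have h2 := ((hasDerivAt_pow m y).div_const (m.factorial : ℝ)).mul h1
  refine h2.congr_deriv ?_
  rcases m with _ | m
  · simp
  · rw [if_neg (Nat.succ_ne_zero m), Nat.add_sub_cancel, Nat.factorial_succ]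
    push_cast
    field_simp
    ring

/-- The point masses of independent Poisson variables with means `c j`. -/
noncomputable def poissonWeight {k : ℕ} (c : Fin k → ℝ) (ν : Fin k → ℕ) : ℝ :=
  ∏ j, (c j ^ ν j / ((ν j).factorial : ℝ) * Real.exp (-c j))

/-- The probability that `∑ j N_j = n` for independent Poisson variables `N_j` with means `c j`. -/
noncomputable def poissonMass {k : ℕ} (n : ℤ) (c : Fin k → ℝ) : ℝ :=
  if n < 0 then 0 else ∑ ν ∈ Theta k n.toNat, poissonWeight c ν

theorem poissonMass_natCast {k : ℕ} (n : ℕ) (c : Fin k → ℝ) :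
    poissonMass (n : ℤ) c = ∑ ν ∈ Theta k n, poissonWeight c ν := by
  simp [poissonMass]

theorem poissonMass_of_neg {k : ℕ} {n : ℤ} (hn : n < 0) (c : Fin k → ℝ) :
    poissonMass n c = 0 := if_pos hn

theorem gprfPmf_eq {k : ℕ} (l : Fin k → ℝ) (a : ℝ) (n : ℕ) :
    gprfPmf l a n = poissonMass (n : ℤ) fun j => l j * a := by
  rw [poissonMass_natCast]
  rfl

theorem poissonWeight_nonneg {k : ℕ} {c : Fin k → ℝ} (hc : ∀ j, 0 ≤ c j) (ν : Fin k → ℕ) :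
    0 ≤ poissonWeight c ν :=
  Finset.prod_nonneg fun j _ => by have := hc j; positivity

theorem poissonWeight_le_one {k : ℕ} {c : Fin k → ℝ} (hc : ∀ j, 0 ≤ c j) (ν : Fin k → ℕ) :
    poissonWeight c ν ≤ 1 := by
  refine Finset.prod_le_one (fun j _ => by have := hc j; positivity) fun j _ => ?_
  calc _ ≤ Real.exp (c j) * Real.exp (-c j) := by
        gcongr
        exact Real.pow_div_factorial_le_exp _ (hc j) _
    _ = 1 := by rw [← Real.exp_add]; simp

theorem poissonMass_nonneg {k : ℕ} (n : ℤ) {c : Fin k → ℝ} (hc : ∀ j, 0 ≤ c j) :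
    0 ≤ poissonMass n c := by
  unfold poissonMass
  split_ifs
  · exact le_rfl
  · exact Finset.sum_nonneg fun ν _ => poissonWeight_nonneg hc ν

theorem abs_poissonMass_le {k : ℕ} (n : ℤ) {c : Fin k → ℝ} (hc : ∀ j, 0 ≤ c j) :
    |poissonMass n c| ≤ (Theta k n.toNat).card := by
  rw [abs_of_nonneg (poissonMass_nonneg n hc)]
  unfold poissonMass
  split_ifs
  · positivity
  · calc _ ≤ ∑ ν ∈ Theta k n.toNat, (1 : ℝ) :=
          Finset.sum_le_sum fun ν _ => poissonWeight_le_one hc ν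
      _ = _ := by simp

theorem hasDerivAt_poissonWeight_comp {k : ℕ} {c : ℝ → Fin k → ℝ} {c' : Fin k → ℝ} {x : ℝ}
    (hc : ∀ j, HasDerivAt (fun t => c t j) (c' j) x) (ν : Fin k → ℕ) :
    HasDerivAt (fun t => poissonWeight (c t) ν)
      (∑ i, c' i * ((if ν i = 0 then 0 else poissonWeight (c x) (ν - Pi.single i 1)) -
        poissonWeight (c x) ν)) x := by
  have hj : ∀ j, HasDerivAt (fun t => c t j ^ ν j / ((ν j).factorial : ℝ) * Real.exp (-c t j))
      (((if ν j = 0 then 0 else c x j ^ (ν j - 1) / ((ν j - 1).factorial : ℝ) *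
        Real.exp (-c x j)) - c x j ^ ν j / ((ν j).factorial : ℝ) * Real.exp (-c x j)) * c' j) x := fun j => by
    have h := (hasDerivAt_poissonWeight (ν j) (c x j)).comp x (hc j)
    exact h
  have h := HasDerivAt.fun_finsetProd (u := Finset.univ) fun j _ => hj j
  refine h.congr_deriv (Finset.sum_congr rfl fun i _ => ?_)
  have e1 : poissonWeight (c x) ν =
      (∏ j ∈ Finset.univ.erase i, (c x j ^ ν j / ((ν j).factorial : ℝ) * Real.exp (-c x j))) *
        (c x i ^ ν i / ((ν i).factorial : ℝ) * Real.exp (-c x i)) := by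
    rw [mul_comm]
    exact (Finset.mul_prod_erase _ _ (Finset.mem_univ i)).symm
  have e2 : poissonWeight (c x) (ν - Pi.single i 1) =
      (∏ j ∈ Finset.univ.erase i, (c x j ^ ν j / ((ν j).factorial : ℝ) * Real.exp (-c x j))) *
        (c x i ^ (ν i - 1) / ((ν i - 1).factorial : ℝ) * Real.exp (-c x i)) := by
    rw [mul_comm, poissonWeight, ← Finset.mul_prod_erase _ _ (Finset.mem_univ i)]
    congr 1
    · simp
    · refine Finset.prod_congr rfl fun j hj => ?_
      simp [Pi.single_eq_of_ne (Finset.ne_of_mem_erase hj)]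
  rw [e1, smul_eq_mul]
  split_ifs with h0
  · ring
  · rw [e2]
    ring

/-- Removing one group of size `i + 1` is a bijection from the tuples with `ν i ≠ 0` onto `Θ(k, n -
(i + 1))`. It turns lowering a Poisson count into a shift of `n`. -/
theorem sum_Theta_sub_single {k : ℕ} (n : ℕ) (i : Fin k) (g : (Fin k → ℕ) → ℝ) :
    ∑ ν ∈ Theta k n, (if ν i = 0 then 0 else g (ν - Pi.single i 1)) =
      if n < (i : ℕ) + 1 then 0 else ∑ ν ∈ Theta k (n - ((i : ℕ) + 1)), g ν := by
  have hsum : ∀ ν : Fin k → ℕ, ∑ j : Fin k, ((j : ℕ) + 1) * (ν + Pi.single i 1 : Fin k → ℕ) j =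
      ∑ j : Fin k, ((j : ℕ) + 1) * ν j + ((i : ℕ) + 1) := by
    intro ν
    simp [mul_add, Finset.sum_add_distrib, Pi.single_apply]
  have hsub : ∀ ν : Fin k → ℕ, ν i ≠ 0 → ν - Pi.single i 1 + Pi.single i 1 = ν := by
    intro ν hν
    ext j
    rcases eq_or_ne j i with rfl | hj
    · simp; omega
    · simp [Pi.single_eq_of_ne hj]
  simp_rw [← ite_not (_ = 0)]
  rw [← Finset.sum_filter]
  split_ifs with hn
  · refine Finset.sum_eq_zero fun ν hν => ?_
    rw [Finset.mem_filter, mem_Theta] at hν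
    have h1 := hsum (ν - Pi.single i 1)
    rw [hsub ν hν.2, hν.1] at h1
    omega
  · refine Finset.sum_nbij' (fun ν => ν - Pi.single i 1) (fun ν => ν + Pi.single i 1) ?_ ?_ ?_ ?_ ?_
    · intro ν hν
      rw [Finset.mem_filter, mem_Theta] at hν
      rw [mem_Theta]
      have h1 := hsum (ν - Pi.single i 1)
      rw [hsub ν hν.2, hν.1] at h1
      omega
    · intro ν hν
      rw [mem_Theta] at hν
      rw [Finset.mem_filter, mem_Theta, hsum, hν]
      refine ⟨by omega, by simp⟩
    · intro ν hν
      exact hsub ν (Finset.mem_filter.mp hν).2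
    · intro ν _
      simp
    · intro ν _
      rfl

/-- Stated along a curve of means, so that the area and the rate `λ₁` are both special cases. -/
theorem hasDerivAt_poissonMass {k : ℕ} {c : ℝ → Fin k → ℝ} {c' : Fin k → ℝ} {x : ℝ}
    (hc : ∀ j, HasDerivAt (fun t => c t j) (c' j) x) (n : ℤ) :
    HasDerivAt (fun t => poissonMass n (c t))
      (∑ i, c' i * (poissonMass (n - ((i : ℕ) + 1 : ℕ)) (c x) - poissonMass n (c x))) x := by
  rcases lt_or_ge n 0 with hn | hn
  · have h : ∀ (i : Fin k), n - ((i : ℕ) + 1 : ℕ) < 0 := fun i => by omega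
    simp only [poissonMass_of_neg hn, poissonMass_of_neg (h _)]
    simpa using hasDerivAt_const x (0 : ℝ)
  lift n to ℕ using hn
  simp only [poissonMass_natCast]
  refine (HasDerivAt.fun_sum fun ν _ => hasDerivAt_poissonWeight_comp hc ν).congr_deriv ?_
  rw [Finset.sum_comm]
  refine Finset.sum_congr rfl fun i _ => ?_
  rw [← Finset.mul_sum, Finset.sum_sub_distrib, sum_Theta_sub_single]
  congr 2
  unfold poissonMass
  split_ifs with h1 h2 h2
  · rfl
  · omega
  · omega
  · congr 2
    omega

/-- The operator `-∑_j λ_j (I - B^j)` on functions of `n`. -/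
noncomputable def shiftOp {k : ℕ} (l : Fin k → ℝ) (g : ℤ → ℝ) (n : ℤ) : ℝ :=
  -∑ j : Fin k, l j * (g n - g (n - ((j : ℕ) + 1 : ℕ)))

theorem hasDerivAt_shiftOp {k : ℕ} (l : Fin k → ℝ) {g g' : ℤ → ℝ → ℝ} {x : ℝ}
    (h : ∀ n, HasDerivAt (g n) (g' n x) x) (n : ℤ) :
    HasDerivAt (fun a => shiftOp l (fun m => g m a) n) (shiftOp l (fun m => g' m x) n) x :=
  (HasDerivAt.fun_sum fun _ _ => ((h n).fun_sub (h _)).const_mul _).fun_neg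

theorem integral_shiftOp {k : ℕ} (l : Fin k → ℝ) {ρ : Measure ℝ} {g : ℤ → ℝ → ℝ}
    (h : ∀ n, Integrable (g n) ρ) (n : ℤ) :
    shiftOp l (fun m => ∫ w, g m w ∂ρ) n = ∫ w, shiftOp l (fun m => g m w) n ∂ρ := by
  unfold shiftOp
  rw [integral_neg, integral_finsetSum _ fun j _ => ((h n).sub' (h _)).const_mul _]
  congr 1
  refine Finset.sum_congr rfl fun j _ => ?_
  rw [integral_const_mul, integral_sub (h n) (h _)]

theorem shiftOp_add {k : ℕ} (l : Fin k → ℝ) (g h : ℤ → ℝ) (n : ℤ) :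
    shiftOp l (fun m => g m + h m) n = shiftOp l g n + shiftOp l h n := by
  unfold shiftOp
  rw [← neg_add, ← Finset.sum_add_distrib]
  congr 1
  exact Finset.sum_congr rfl fun j _ => by ring

theorem shiftOp_const_mul {k : ℕ} (l : Fin k → ℝ) (a : ℝ) (g : ℤ → ℝ) (n : ℤ) :
    shiftOp l (fun m => a * g m) n = a * shiftOp l g n := by
  unfold shiftOp
  rw [mul_neg, Finset.mul_sum]
  congr 1
  exact Finset.sum_congr rfl fun j _ => by ring

theorem exists_bound_shiftOp {k : ℕ} (l : Fin k → ℝ) {g : ℤ → ℝ → ℝ}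
    (h : ∀ n, ∃ C, ∀ a, 0 ≤ a → |g n a| ≤ C) (n : ℤ) :
    ∃ C, ∀ a, 0 ≤ a → |shiftOp l (fun m => g m a) n| ≤ C := by
  choose C hC using h
  refine ⟨∑ j : Fin k, |l j| * (C n + C (n - ((j : ℕ) + 1 : ℕ))), fun a ha => ?_⟩
  rw [shiftOp, abs_neg]
  refine (Finset.abs_sum_le_sum_abs _ _).trans (Finset.sum_le_sum fun j _ => ?_)
  rw [abs_mul]
  exact mul_le_mul_of_nonneg_left ((abs_sub _ _).trans (add_le_add (hC _ _ ha) (hC _ _ ha)))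
    (abs_nonneg _)

theorem exists_bound_poissonMass {k : ℕ} {l : Fin k → ℝ} (hl : ∀ j, 0 < l j) (n : ℤ) :
    ∃ C, ∀ a, 0 ≤ a → |poissonMass n fun j => l j * a| ≤ C :=
  ⟨_, fun _ ha => abs_poissonMass_le n fun j => mul_nonneg (hl j).le ha⟩

/-- The forward equation of the counting law, with area in the role of time. -/
theorem hasDerivAt_poissonMass_area {k : ℕ} (l : Fin k → ℝ) (n : ℤ) (a : ℝ) :
    HasDerivAt (fun a => poissonMass n fun j => l j * a)
      (shiftOp l (fun m => poissonMass m fun j => l j * a) n) a := by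
  refine (hasDerivAt_poissonMass (c := fun a j => l j * a) (c' := l)
    (fun j => by simpa using (hasDerivAt_id a).const_mul (l j)) n).congr_deriv ?_
  rw [shiftOp, ← Finset.sum_neg_distrib]
  exact Finset.sum_congr rfl fun j _ => by ring

theorem hasDerivAt_poissonMass_rate {k : ℕ} [NeZero k] (l : Fin k → ℝ) (n : ℤ) (a x : ℝ) :
    HasDerivAt (fun x => poissonMass n fun j => Function.update l 0 x j * a)
      (a * (poissonMass (n - 1) (fun j => Function.update l 0 x j * a) -
        poissonMass n fun j => Function.update l 0 x j * a)) x := by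
  refine (hasDerivAt_poissonMass (c := fun x j => Function.update l 0 x j * a)
    (c' := fun j => if j = 0 then a else 0) (fun j => ?_) n).congr_deriv ?_
  · rcases eq_or_ne j 0 with rfl | hj
    · simpa using (hasDerivAt_id x).mul_const a
    · simpa [hj] using hasDerivAt_const x (l j * a)
  · simp

theorem continuous_poissonMass_area {k : ℕ} (l : Fin k → ℝ) (n : ℤ) :
    Continuous fun a => poissonMass n fun j => l j * a :=
  continuous_iff_continuousAt.mpr fun a => (hasDerivAt_poissonMass_area l n a).continuousAt

/-! ### Products of independent Mittag-Leffler variables -/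

/-- The law of the product of independent variables with laws `ν₁` and `ν₂`. -/
noncomputable def productLaw (ν₁ ν₂ : Measure ℝ) : Measure ℝ :=
  (ν₁.prod ν₂).map fun p => p.1 * p.2

section ProductLaw

variable {α β : ℝ} {ν₁ ν₂ : Measure ℝ}

theorem integral_productLaw {g : ℝ → ℝ} (hg : Measurable g) :
    ∫ w, g w ∂(productLaw ν₁ ν₂) = ∫ p, g (p.1 * p.2) ∂(ν₁.prod ν₂) :=
  integral_map (by fun_prop) hg.aestronglyMeasurable

theorem integrable_productLaw_iff {g : ℝ → ℝ} (hg : Measurable g) :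
    Integrable g (productLaw ν₁ ν₂) ↔ Integrable (fun p => g (p.1 * p.2)) (ν₁.prod ν₂) :=
  integrable_map_measure hg.aestronglyMeasurable (by fun_prop)

theorem IsMLLaw.isProbabilityMeasure_productLaw (h₁ : IsMLLaw α ν₁) (h₂ : IsMLLaw β ν₂) :
    IsProbabilityMeasure (productLaw ν₁ ν₂) := by
  have := h₁.prob
  have := h₂.prob
  exact Measure.isProbabilityMeasure_map (by fun_prop)

theorem IsMLLaw.productLaw_nonneg (h₁ : IsMLLaw α ν₁) (h₂ : IsMLLaw β ν₂) :
    ∀ᵐ w ∂(productLaw ν₁ ν₂), 0 ≤ w := by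
  have := h₁.prob
  have := h₂.prob
  rw [productLaw, ae_map_iff (by fun_prop) measurableSet_Ici]
  filter_upwards [Measure.quasiMeasurePreserving_fst.ae h₁.nonneg,
    Measure.quasiMeasurePreserving_snd.ae h₂.nonneg] with p hp1 hp2
  exact mul_nonneg hp1 hp2

theorem IsMLLaw.integrable_productLaw_pow (h₁ : IsMLLaw α ν₁) (h₂ : IsMLLaw β ν₂) (r : ℕ) :
    Integrable (fun w : ℝ => w ^ r) (productLaw ν₁ ν₂) := by
  have := h₁.prob
  have := h₂.prob
  rw [integrable_productLaw_iff (by fun_prop)]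
  simp_rw [mul_pow]
  exact (h₁.integrable r).mul_prod (h₂.integrable r)

theorem IsMLLaw.integral_productLaw_pow (h₁ : IsMLLaw α ν₁) (h₂ : IsMLLaw β ν₂) (r : ℕ) :
    ∫ w, w ^ r ∂(productLaw ν₁ ν₂) = (r.factorial : ℝ) / Real.Gamma (α * r + 1) *
      ((r.factorial : ℝ) / Real.Gamma (β * r + 1)) := by
  have := h₁.prob
  have := h₂.prob
  rw [integral_productLaw (by fun_prop)]
  simp_rw [mul_pow]
  rw [integral_prod_mul (fun x : ℝ => x ^ r) (fun y : ℝ => y ^ r), h₁.moment, h₂.moment]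

theorem IsMLLaw.integrable_productLaw_of_le (h₁ : IsMLLaw α ν₁) (h₂ : IsMLLaw β ν₂) {g : ℝ → ℝ}
    (hg : Measurable g) {C : ℝ} {r : ℕ} (hC : ∀ x, 0 ≤ x → |g x| ≤ C * x ^ r) :
    Integrable g (productLaw ν₁ ν₂) := by
  refine ((h₁.integrable_productLaw_pow h₂ r).const_mul C).mono' hg.aestronglyMeasurable ?_
  filter_upwards [h₁.productLaw_nonneg h₂] with w hw using hC w hw

theorem IsMLLaw.hasDerivAt_integral_comp_mul (hν : IsMLLaw α ν₁) {f f' : ℝ → ℝ}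
    (hf : Measurable f) (hf' : Measurable f') {C : ℝ} (hC : ∀ x, 0 ≤ x → |f x| ≤ C)
    (hC' : ∀ x, 0 ≤ x → |f' x| ≤ C) (hd : ∀ x, HasDerivAt f (f' x) x) {s : ℝ} (hs : 0 < s) :
    HasDerivAt (fun σ => ∫ x, f (σ * x) ∂ν₁) (∫ x, f' (s * x) * x ∂ν₁) s := by
  have hC0 : 0 ≤ C := (abs_nonneg _).trans (hC 0 le_rfl)
  have hle : ∀ x : ℝ, 0 ≤ x → C ≤ C * (1 + x) := fun x hx => by nlinarith
  have h := hν.hasDerivAt_mix (α := 1) ⟨one_pos, le_rfl⟩ hf hf' (C := C)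
    (fun x hx => (hC x hx).trans (hle x hx)) (fun x hx => (hC' x hx).trans (hle x hx))
    (fun x _ => hd x) hs
  simpa using h

theorem IsMLLaw.abs_integral_comp_mul_le (hν : IsMLLaw α ν₁) {g : ℝ → ℝ} {C c : ℝ}
    (hC : ∀ x, 0 ≤ x → |g x| ≤ C) (hc : 0 ≤ c) : |∫ x, g (c * x) ∂ν₁| ≤ C := by
  have := hν.prob
  have h := norm_integral_le_of_norm_le (μ := ν₁) (f := fun x => g (c * x))
    (integrable_const C) (by
      filter_upwards [hν.nonneg] with x hx using hC _ (mul_nonneg hc hx))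
  simpa using h

theorem IsMLLaw.abs_integral_comp_mul_mul_le (hν : IsMLLaw α ν₁) {g : ℝ → ℝ} {C c : ℝ}
    (hC : ∀ x, 0 ≤ x → |g x| ≤ C) (hc : 0 ≤ c) :
    |∫ x, g (c * x) * x ∂ν₁| ≤ C * ∫ x, x ∂ν₁ := by
  have h := norm_integral_le_of_norm_le (μ := ν₁) (f := fun x => g (c * x) * x)
    (g := fun x => C * x) (by simpa using (hν.integrable 1).const_mul C) (by
      filter_upwards [hν.nonneg] with x hx
      rw [Real.norm_eq_abs, abs_mul, abs_of_nonneg hx]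
      exact mul_le_mul_of_nonneg_right (hC _ (mul_nonneg hc hx)) hx)
  rwa [integral_const_mul] at h

/-- The iterated Caputo derivative of `(s, t) ↦ E q(s^α t^β W)`, where `W` is the product of
independent Mittag-Leffler variables. -/
theorem IsMLLaw.caputo_pair (hα : α ∈ Ioc (0 : ℝ) 1) (hβ : β ∈ Ioc (0 : ℝ) 1)
    (h₁ : IsMLLaw α ν₁) (h₂ : IsMLLaw β ν₂) {q q₁ q₂ : ℝ → ℝ}
    (hq : ∀ x, HasDerivAt q (q₁ x) x) (hq₁ : ∀ x, HasDerivAt q₁ (q₂ x) x) (hm₂ : Measurable q₂)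
    {C : ℝ} (hC : ∀ x, 0 ≤ x → |q x| ≤ C) (hC₁ : ∀ x, 0 ≤ x → |q₁ x| ≤ C)
    (hC₂ : ∀ x, 0 ≤ x → |q₂ x| ≤ C) {P : ℝ → ℝ → ℝ}
    (hP : ∀ s t, 0 < s → 0 < t → P s t = ∫ w, q (s ^ α * t ^ β * w) ∂(productLaw ν₁ ν₂))
    {s t : ℝ} (hs : 0 < s) (ht : 0 < t) :
    CaputoDifferentiableAt α (fun s' => P s' t) s ∧
    CaputoDifferentiableAt β (fun t' => caputoDeriv α (fun s' => P s' t') s) t ∧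
    caputoDeriv β (fun t' => caputoDeriv α (fun s' => P s' t') s) t =
      ∫ w, (q₁ (s ^ α * t ^ β * w) + s ^ α * t ^ β * w * q₂ (s ^ α * t ^ β * w))
        ∂(productLaw ν₁ ν₂) := by
  have := h₁.prob
  have := h₂.prob
  have hC0 : 0 ≤ C := (abs_nonneg _).trans (hC 0 le_rfl)
  have hm : Measurable q := (continuous_iff_continuousAt.mpr fun x => (hq x).continuousAt).measurable
  have hm₁ : Measurable q₁ :=
    (continuous_iff_continuousAt.mpr fun x => (hq₁ x).continuousAt).measurable
  have hE₁ : 0 ≤ ∫ x, x ∂ν₁ := integral_nonneg_of_ae h₁.nonneg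
  have hE₂ : 0 ≤ ∫ x, x ∂ν₂ := integral_nonneg_of_ae h₂.nonneg
  have hsα : 0 < s ^ α := by positivity
  -- For fixed `t'` the function of `s` is `E f(s^α ξ)` with `f a = E q(t'^β a η)`. Every `t' > 0`
  -- is needed, because the second derivative acts on the result as a function of `t'`.
  have hfst : ∀ t' : ℝ, 0 < t' → CaputoDifferentiableAt α (fun s' => P s' t') s ∧
      caputoDeriv α (fun s' => P s' t') s =
        ∫ x, ∫ y, t' ^ β * q₁ (t' ^ β * (s ^ α * x * y)) * y ∂ν₂ ∂ν₁ := by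
    intro t' ht'
    have hb : 0 < t' ^ β := by positivity
    set b := t' ^ β with hb_def
    have hgC' : ∀ x, 0 ≤ x → |b * q₁ (b * x)| ≤ b * C := fun x hx => by
      rw [abs_mul, abs_of_pos hb]
      exact mul_le_mul_of_nonneg_left (hC₁ _ (by positivity)) hb.le
    have hgC : ∀ x, 0 ≤ x → |q (b * x)| ≤ C := fun x hx => hC _ (by positivity)
    refine h₁.caputo hα (f := fun a => ∫ y, q (b * (a * y)) ∂ν₂)
      (f' := fun a => ∫ y, b * q₁ (b * (a * y)) * y ∂ν₂) (C := C + b * C * ∫ y, y ∂ν₂)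
      ?_ ?_ ?_ ?_ ?_ ?_ hs
    · exact (StronglyMeasurable.integral_prod_right (f := fun a y => q (b * (a * y)))
        (by fun_prop : Measurable _).stronglyMeasurable).measurable
    · exact (StronglyMeasurable.integral_prod_right (f := fun a y => b * q₁ (b * (a * y)) * y)
        (by fun_prop : Measurable _).stronglyMeasurable).measurable
    · intro x hx
      have h3 := h₂.abs_integral_comp_mul_le hgC hx
      have : 0 ≤ b * C * ∫ y, y ∂ν₂ := by positivity
      nlinarith
    · intro x hx
      have h3 := h₂.abs_integral_comp_mul_mul_le hgC' hx
      have : 0 ≤ b * C * ∫ y, y ∂ν₂ := by positivity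
      nlinarith
    · intro x hx
      refine h₂.hasDerivAt_integral_comp_mul (f := fun x => q (b * x))
        (f' := fun x => b * q₁ (b * x)) (C := C + b * C) (by fun_prop) (by fun_prop)
        (fun x hx => (hgC x hx).trans (by nlinarith)) (fun x hx => (hgC' x hx).trans (by linarith))
        (fun x => ?_) hx
      have h3 : HasDerivAt (fun x => b * x) b x := by
        simpa using (hasDerivAt_id x).const_mul b
      have h4 := (hq (b * x)).comp x h3
      rw [mul_comm] at h4
      exact h4
    · intro σ hσ
      have hσα : 0 < σ ^ α := by positivity
      rw [hP σ t' hσ ht', integral_productLaw (by fun_prop), integral_prod]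
      · refine integral_congr_ae (ae_of_all _ fun x => integral_congr_ae (ae_of_all _ fun y => ?_))
        simp only
        congr 1
        ring
      · refine (integrable_productLaw_iff (g := fun w => q (σ ^ α * t' ^ β * w)) (by fun_prop)).mp ?_
        refine h₁.integrable_productLaw_of_le h₂ (C := C) (r := 0) (by fun_prop) fun x hx => ?_
        rw [pow_zero, mul_one]
        exact hC _ (by positivity)
  refine ⟨(hfst t ht).1, ?_⟩
  have hgC₁ : ∀ x, 0 ≤ x → |q₁ (s ^ α * x)| ≤ C := fun x hx => hC₁ _ (by positivity)
  have hgC₂ : ∀ x, 0 ≤ x → |s ^ α * q₂ (s ^ α * x)| ≤ s ^ α * C := fun x hx => by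
    rw [abs_mul, abs_of_pos hsα]
    exact mul_le_mul_of_nonneg_left (hC₂ _ (by positivity)) hsα.le
  -- After exchanging integrals, the first derivative is `E f(t^β η)` with `f z = z E q₁(s^α z ξ)`.
  -- The product rule for `f` produces the two terms of the conclusion.
  have key := h₂.caputo hβ (f := fun z => z * ∫ x, q₁ (s ^ α * (z * x)) ∂ν₁)
    (f' := fun z => (∫ x, q₁ (s ^ α * (z * x)) ∂ν₁) +
      z * ∫ x, s ^ α * q₂ (s ^ α * (z * x)) * x ∂ν₁)
    (F := fun t' => caputoDeriv α (fun s' => P s' t') s)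
    (C := C + s ^ α * C * ∫ x, x ∂ν₁) (s := t) ?_ ?_ ?_ ?_ ?_ ?_ ht
  · refine ⟨key.1, key.2.trans ?_⟩
    have hc : 0 < s ^ α * t ^ β := by positivity
    have hi1 : Integrable (fun w => q₁ (s ^ α * t ^ β * w)) (productLaw ν₁ ν₂) := by
      refine h₁.integrable_productLaw_of_le h₂ (C := C) (r := 0) (by fun_prop) fun x hx => ?_
      rw [pow_zero, mul_one]
      exact hC₁ _ (by positivity)
    have hi2 : Integrable (fun w => s ^ α * t ^ β * w * q₂ (s ^ α * t ^ β * w))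
        (productLaw ν₁ ν₂) := by
      refine h₁.integrable_productLaw_of_le h₂ (C := s ^ α * t ^ β * C) (r := 1) (by fun_prop)
        fun x hx => ?_
      rw [pow_one, abs_mul, abs_of_nonneg (by positivity : 0 ≤ s ^ α * t ^ β * x),
        mul_right_comm _ C x]
      exact mul_le_mul_of_nonneg_left (hC₂ _ (by positivity)) (by positivity)
    rw [integral_add hi1 hi2, integral_productLaw (by fun_prop), integral_productLaw (by fun_prop),
      integral_prod_symm _ ((integrable_productLaw_iff (by fun_prop)).mp hi1),
      integral_prod_symm _ ((integrable_productLaw_iff (by fun_prop)).mp hi2), integral_add]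
    · congr 1
      · refine integral_congr_ae (ae_of_all _ fun y => integral_congr_ae (ae_of_all _ fun x => ?_))
        simp only
        congr 1
        ring
      · refine integral_congr_ae (ae_of_all _ fun y => ?_)
        simp only
        rw [← integral_const_mul]
        refine integral_congr_ae (ae_of_all _ fun x => ?_)
        simp only
        rw [show s ^ α * (t ^ β * y * x) = s ^ α * t ^ β * (x * y) by ring]
        ring
    · refine (((integrable_productLaw_iff (by fun_prop)).mp hi1).integral_prod_right).congr
        (ae_of_all _ fun y => integral_congr_ae (ae_of_all _ fun x => ?_))
      simp only
      congr 1
      ring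
    · refine (((integrable_productLaw_iff (by fun_prop)).mp hi2).integral_prod_right).congr
        (ae_of_all _ fun y => ?_)
      simp only
      rw [← integral_const_mul]
      refine integral_congr_ae (ae_of_all _ fun x => ?_)
      simp only
      rw [show s ^ α * (t ^ β * y * x) = s ^ α * t ^ β * (x * y) by ring]
      ring
  · exact measurable_id.mul (StronglyMeasurable.integral_prod_right
      (f := fun z x => q₁ (s ^ α * (z * x)))
      (by fun_prop : Measurable _).stronglyMeasurable).measurable
  · exact (StronglyMeasurable.integral_prod_right (f := fun z x => q₁ (s ^ α * (z * x)))
      (by fun_prop : Measurable _).stronglyMeasurable).measurable.add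
      (measurable_id.mul (StronglyMeasurable.integral_prod_right
        (f := fun z x => s ^ α * q₂ (s ^ α * (z * x)) * x)
        (by fun_prop : Measurable _).stronglyMeasurable).measurable)
  · intro z hz
    have h3 := h₁.abs_integral_comp_mul_le hgC₁ hz
    have h5 : 0 ≤ s ^ α * C * ∫ y, y ∂ν₁ := by positivity
    rw [abs_mul, abs_of_nonneg hz]
    nlinarith [mul_le_mul_of_nonneg_left h3 hz, mul_nonneg h5 hz]
  · intro z hz
    have h3 := h₁.abs_integral_comp_mul_le hgC₁ hz
    have h4 := h₁.abs_integral_comp_mul_mul_le hgC₂ hz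
    have h5 : 0 ≤ s ^ α * C * ∫ y, y ∂ν₁ := by positivity
    refine (abs_add_le _ _).trans ?_
    rw [abs_mul, abs_of_nonneg hz]
    nlinarith [mul_le_mul_of_nonneg_left h4 hz, mul_nonneg hC0 hz]
  · intro z hz
    have h3 := h₁.hasDerivAt_integral_comp_mul (f := fun x => q₁ (s ^ α * x))
      (f' := fun x => s ^ α * q₂ (s ^ α * x)) (C := C + s ^ α * C) (by fun_prop) (by fun_prop)
      (fun x hx => (hgC₁ x hx).trans (by nlinarith)) (fun x hx => (hgC₂ x hx).trans (by linarith))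
      (fun x => ?_) hz
    · refine ((hasDerivAt_id z).mul h3).congr_deriv ?_
      simp
    · have h3 : HasDerivAt (fun x => s ^ α * x) (s ^ α) x := by
        simpa using (hasDerivAt_id x).const_mul (s ^ α)
      have h4 := (hq₁ (s ^ α * x)).comp x h3
      rw [mul_comm] at h4
      exact h4
  · intro t' ht'
    have hb : 0 < t' ^ β := by positivity
    rw [(hfst t' ht').2]
    have hi : Integrable (fun p : ℝ × ℝ => t' ^ β * q₁ (t' ^ β * (s ^ α * p.1 * p.2)) * p.2)
        (ν₁.prod ν₂) := by
      have h6 : Integrable (fun p : ℝ × ℝ => (t' ^ β * C) * p.2) (ν₁.prod ν₂) := by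
        have := (h₁.integrable 0).mul_prod (h₂.integrable 1)
        simpa using this.const_mul (t' ^ β * C)
      refine h6.mono' (by fun_prop : Measurable _).aestronglyMeasurable ?_
      filter_upwards [Measure.quasiMeasurePreserving_fst.ae h₁.nonneg,
        Measure.quasiMeasurePreserving_snd.ae h₂.nonneg] with p hp1 hp2
      rw [Real.norm_eq_abs, abs_mul, abs_mul, abs_of_pos hb, abs_of_nonneg hp2]
      have := hC₁ (t' ^ β * (s ^ α * p.1 * p.2)) (by positivity)
      gcongr
    rw [integral_integral_swap hi]
    refine integral_congr_ae (ae_of_all _ fun y => ?_)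
    simp only
    rw [← integral_const_mul]
    refine integral_congr_ae (ae_of_all _ fun x => ?_)
    simp only
    rw [show t' ^ β * (s ^ α * x * y) = s ^ α * (t' ^ β * y * x) by ring]
    ring

end ProductLaw

/-! ### The governing operator -/

/-- The operator identity `∑_r B^(J-r) (I - B) = I - B^J`. -/
theorem sum_Icc_telescope (A : ℤ → ℝ) (m : ℤ) (J : ℕ) :
    ∑ r ∈ Finset.Icc 1 J, (A (m - (J - r : ℕ)) - A (m - (J - r : ℕ) - 1)) = A m - A (m - J) := by
  have h : ∑ r ∈ Finset.Icc 1 J, (A (m - (J - r : ℕ)) - A (m - (J - r : ℕ) - 1)) =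
      ∑ i ∈ Finset.range J, (A (m - (i : ℕ)) - A (m - (i + 1 : ℕ))) := by
    refine Finset.sum_nbij' (fun r => J - r) (fun i => J - i) ?_ ?_ ?_ ?_ ?_
    · intro r hr; simp only [Finset.mem_Icc, Finset.mem_range] at *; omega
    · intro r hr; simp only [Finset.mem_Icc, Finset.mem_range] at *; omega
    · intro r hr; simp only [Finset.mem_Icc] at *; omega
    · intro r hr; simp only [Finset.mem_range] at *; omega
    · intro r hr
      congr 2
      push_cast
      ring
  rw [h, Finset.sum_range_sub' (fun i : ℕ => A (m - i))]
  simp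

theorem integrable_shiftOp {k : ℕ} (l : Fin k → ℝ) {ρ : Measure ℝ} {g : ℤ → ℝ → ℝ}
    (h : ∀ n, Integrable (g n) ρ) (n : ℤ) : Integrable (fun w => shiftOp l (fun m => g m w) n) ρ :=
  (integrable_finsetSum _ fun j _ => ((h n).sub' (h _)).const_mul (l j)).neg

section Governing

variable {k : ℕ} [NeZero k] {ρ : Measure ℝ} {c : ℝ} {F : (Fin k → ℝ) → ℤ → ℝ}
  {l : Fin k → ℝ}

theorem hasDerivAt_rate_integral [IsProbabilityMeasure ρ] (hρ : ∀ᵐ w ∂ρ, 0 ≤ w)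
    (hi : ∀ r : ℕ, Integrable (fun w : ℝ => w ^ r) ρ) (hc : 0 ≤ c)
    (hF : ∀ l : Fin k → ℝ, (∀ j, 0 < l j) → ∀ m,
      F l m = ∫ w, poissonMass m (fun j => l j * (c * w)) ∂ρ)
    (hl : ∀ j, 0 < l j) (m : ℤ) :
    HasDerivAt (fun x => F (Function.update l 0 x) m)
      (∫ w, c * w * (poissonMass (m - 1) (fun j => l j * (c * w)) -
        poissonMass m (fun j => l j * (c * w))) ∂ρ) (l 0) := by
  have hup : ∀ {x : ℝ}, 0 < x → ∀ j, 0 < Function.update l 0 x j := by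
    intro x hx j
    rcases eq_or_ne j 0 with rfl | hj
    · simpa using hx
    · simpa [hj] using hl j
  have hmeas : ∀ (l : Fin k → ℝ) m, Measurable fun w => poissonMass m (fun j => l j * (c * w)) :=
    fun l m => (continuous_poissonMass_area l m).measurable.comp (measurable_const_mul c)
  set B : ℤ → ℝ := fun m => ((Theta k m.toNat).card : ℝ) with hB
  have hbound : ∀ {x : ℝ}, 0 < x → ∀ m {w : ℝ}, 0 ≤ w →
      |poissonMass m (fun j => Function.update l 0 x j * (c * w))| ≤ B m :=
    fun hx m w hw => abs_poissonMass_le m fun j => mul_nonneg (hup hx j).le (mul_nonneg hc hw)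
  have key := (hasDerivAt_integral_of_dominated_loc_of_deriv_le (μ := ρ) (s := Ioi 0) (x₀ := l 0)
    (F := fun x w => poissonMass m (fun j => Function.update l 0 x j * (c * w)))
    (F' := fun x w => c * w * (poissonMass (m - 1) (fun j => Function.update l 0 x j * (c * w)) -
        poissonMass m (fun j => Function.update l 0 x j * (c * w))))
    (bound := fun w => c * w * (B (m - 1) + B m))
    (Ioi_mem_nhds (hl 0)) ?_ ?_ ?_ ?_ ?_ ?_).2
  · rw [Function.update_eq_self] at key
    refine key.congr_of_eventuallyEq ?_
    -- The formula for `F` is known only at positive rates, which contain a neighbourhood of `l 0`.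
    filter_upwards [Ioi_mem_nhds (hl 0)] with x hx
    exact hF _ (hup hx) m
  · exact Eventually.of_forall fun x => (hmeas _ m).aestronglyMeasurable
  · refine (integrable_const (B m)).mono' (hmeas _ m).aestronglyMeasurable ?_
    filter_upwards [hρ] with w hw using hbound (hl 0) m hw
  · exact (((measurable_const_mul c).mul ((hmeas _ _).sub (hmeas _ _)))).aestronglyMeasurable
  · filter_upwards [hρ] with w hw x hx
    rw [Real.norm_eq_abs, abs_mul, abs_of_nonneg (mul_nonneg hc hw)]
    exact mul_le_mul_of_nonneg_left ((abs_sub _ _).trans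
      (add_le_add (hbound hx _ hw) (hbound hx _ hw))) (mul_nonneg hc hw)
  · have := (hi 1).const_mul c
    simp only [pow_one] at this
    exact this.mul_const _
  · exact ae_of_all _ fun w x _ => hasDerivAt_poissonMass_rate l m (c * w) x

theorem governingOperator_integral [IsProbabilityMeasure ρ] (hρ : ∀ᵐ w ∂ρ, 0 ≤ w)
    (hi : ∀ r : ℕ, Integrable (fun w : ℝ => w ^ r) ρ) (hc : 0 ≤ c)
    (hF : ∀ l : Fin k → ℝ, (∀ j, 0 < l j) → ∀ m,
      F l m = ∫ w, poissonMass m (fun j => l j * (c * w)) ∂ρ)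
    (hl : ∀ j, 0 < l j) (n : ℤ) :
    governingOperator F l n =
      ∫ w, (shiftOp l (fun m => poissonMass m fun j => l j * (c * w)) n + c * w *
        shiftOp l (fun m' => shiftOp l (fun m => poissonMass m fun j => l j * (c * w)) m') n) ∂ρ := by
  have hmeas : ∀ m, Measurable fun w => poissonMass m (fun j => l j * (c * w)) :=
    fun m => (continuous_poissonMass_area l m).measurable.comp (measurable_const_mul c)
  have hb : ∀ m, ∀ᵐ w ∂ρ, |poissonMass m (fun j => l j * (c * w))| ≤ (Theta k m.toNat).card := by
    intro m
    filter_upwards [hρ] with w hw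
    exact abs_poissonMass_le m fun j => mul_nonneg (hl j).le (mul_nonneg hc hw)
  have hi0 : ∀ m, Integrable (fun w => poissonMass m (fun j => l j * (c * w))) ρ := fun m =>
    (integrable_const _).mono' (hmeas m).aestronglyMeasurable (hb m)
  have hcw : Integrable (fun w => c * w) ρ := by simpa using (hi 1).const_mul c
  have hi1 : ∀ m, Integrable (fun w => c * w * poissonMass m (fun j => l j * (c * w))) ρ :=
    fun m => hcw.mul_bdd (hmeas m).aestronglyMeasurable (hb m)
  set A : ℤ → ℝ := fun m => ∫ w, c * w * poissonMass m (fun j => l j * (c * w)) ∂ρ with hA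
  have hD : ∀ m, derivRateOne F l m = -(A m - A (m - 1)) := by
    intro m
    rw [derivRateOne, (hasDerivAt_rate_integral hρ hi hc hF hl m).deriv, neg_sub, hA]
    simp only
    rw [← integral_sub (hi1 _) (hi1 _)]
    simp_rw [mul_sub]
  have hsh : ∀ m, shiftOp l A m = ∫ w, c * w *
      shiftOp l (fun m => poissonMass m fun j => l j * (c * w)) m ∂ρ := by
    intro m
    rw [hA, integral_shiftOp l hi1]
    simp_rw [shiftOp_const_mul]
  -- By `hD` the rate derivative is `-(I - B) A`, so the sum over `r` telescopes to `-(I - B^j) A`.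
  have hinner : ∀ m, innerOperator F l m = F l m + shiftOp l A m := by
    intro m
    rw [innerOperator, shiftOp, ← Finset.sum_neg_distrib]
    congr 1
    refine Finset.sum_congr rfl fun j _ => ?_
    simp only [backwardShift, hD, Finset.sum_neg_distrib]
    rw [sum_Icc_telescope]
    ring
  have hi2 : ∀ m, Integrable (fun w => c * w *
      shiftOp l (fun m => poissonMass m fun j => l j * (c * w)) m) ρ := fun m =>
    (integrable_shiftOp l hi1 m).congr (ae_of_all _ fun w => shiftOp_const_mul l (c * w) _ m)
  have hi4 : Integrable (fun w => c * w * shiftOp l (fun m' =>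
      shiftOp l (fun m => poissonMass m fun j => l j * (c * w)) m') n) ρ :=
    (integrable_shiftOp l hi2 n).congr (ae_of_all _ fun w => shiftOp_const_mul l (c * w) _ n)
  have hgov : governingOperator F l n = shiftOp l (fun m => F l m + shiftOp l A m) n := by
    simp only [governingOperator, shiftOp, backwardShift, hinner]
  rw [hgov, shiftOp_add, integral_add (integrable_shiftOp l hi0 n) hi4]
  congr 1
  · rw [funext (hF l hl)]
    exact integral_shiftOp l hi0 n
  · rw [funext hsh, integral_shiftOp l hi2]
    simp_rw [shiftOp_const_mul]

end Governing

/-! ### The generalized Wright function as a Laplace transform -/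

section Wright

variable {α β : ℝ} {ν₁ ν₂ : Measure ℝ}

theorem IsMLLaw.wrightTerm_eq (h₁ : IsMLLaw α ν₁) (h₂ : IsMLLaw β ν₂) (N : ℕ) (x : ℝ) (r : ℕ) :
    wrightTerm (wrightUpper N) (wrightLower α β N) x r =
      x ^ r / r.factorial * ∫ w, w ^ (N + r) ∂(productLaw ν₁ ν₂) := by
  rw [wrightTerm_upper_lower, h₁.integral_productLaw_pow h₂, mul_comm]

/-- Termwise integration of the exponential series; `θ` is the damping parameter of Abel summation.
-/
theorem IsMLLaw.hasSum_wrightTerm_mul_pow (h₁ : IsMLLaw α ν₁) (h₂ : IsMLLaw β ν₂) (N : ℕ)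
    (x : ℝ) {θ : ℝ}
    (hs : Summable fun r => |wrightTerm (wrightUpper N) (wrightLower α β N) x r * θ ^ r|) :
    HasSum (fun r => wrightTerm (wrightUpper N) (wrightLower α β N) x r * θ ^ r)
      (∫ w, w ^ N * Real.exp (x * θ * w) ∂(productLaw ν₁ ν₂)) := by
  have e : ∀ r, wrightTerm (wrightUpper N) (wrightLower α β N) x r * θ ^ r =
      ∫ w, (x * θ) ^ r / r.factorial * w ^ (N + r) ∂(productLaw ν₁ ν₂) := by
    intro r
    rw [h₁.wrightTerm_eq h₂, integral_const_mul, mul_pow]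
    ring
  have key := hasSum_integral_of_summable_integral_norm (μ := productLaw ν₁ ν₂)
    (F := fun (r : ℕ) (w : ℝ) => (x * θ) ^ r / r.factorial * w ^ (N + r))
    (fun r => (h₁.integrable_productLaw_pow h₂ (N + r)).const_mul _) ?_
  · simp_rw [e]
    have h : ∀ w : ℝ, w ^ N * Real.exp (x * θ * w) =
        ∑' r : ℕ, (x * θ) ^ r / r.factorial * w ^ (N + r) := by
      intro w
      have := (NormedSpace.expSeries_div_hasSum_exp (x * θ * w)).tsum_eq
      rw [← Real.exp_eq_exp_ℝ] at this
      rw [← this, ← tsum_mul_left]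
      refine tsum_congr fun r => ?_
      rw [mul_pow (x * θ), pow_add]
      ring
    simp_rw [h]
    exact key
  · refine hs.congr fun r => ?_
    rw [e, integral_const_mul, abs_mul]
    simp only [norm_mul]
    rw [integral_const_mul]
    congr 1
    rw [abs_of_nonneg]
    · refine integral_congr_ae ?_
      filter_upwards [h₁.productLaw_nonneg h₂] with w hw
      rw [Real.norm_eq_abs, abs_of_nonneg (by positivity)]
    · refine integral_nonneg_of_ae ?_
      filter_upwards [h₁.productLaw_nonneg h₂] with w hw
      exact pow_nonneg hw _

/-- Where the series of the generalized Wright function converges (possibly conditionally), its sum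
is a moment of the Laplace transform of a product of Mittag-Leffler variables. -/
theorem IsMLLaw.generalizedWright_eq (h₁ : IsMLLaw α ν₁) (h₂ : IsMLLaw β ν₂) (N : ℕ) {x : ℝ}
    (hx : x ≤ 0) (hconv : WrightConverges (wrightUpper N) (wrightLower α β N) x) :
    generalizedWright (wrightUpper N) (wrightLower α β N) x =
      ∫ w, w ^ N * Real.exp (x * w) ∂(productLaw ν₁ ν₂) := by
  set f := wrightTerm (wrightUpper N) (wrightLower α β N) x with hf
  have hlim : Tendsto (fun n => ∑ i ∈ Finset.range n, f i) atTop
      (𝓝 (generalizedWright (wrightUpper N) (wrightLower α β N) x)) := by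
    have h := Summable.hasSum hconv
    rw [HasSum, SummationFilter.conditional_filter_eq_map_range, tendsto_map'_iff] at h
    exact h
  have habel := Real.tendsto_tsum_powerSeries_nhdsWithin_lt hlim
  -- Convergence makes the terms bounded, so damping by `θ^r` with `θ < 1` gives absolute
  -- summability.
  have hf0 : Tendsto f atTop (𝓝 0) := by
    have h := (hlim.comp (tendsto_add_atTop_nat 1)).sub hlim
    simpa [Function.comp_def, Finset.sum_range_succ] using h
  obtain ⟨K, hK⟩ : ∃ K, ∀ r, |f r| ≤ K := by
    obtain ⟨K, hK⟩ := hf0.abs.bddAbove_range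
    exact ⟨K, fun r => hK ⟨r, rfl⟩⟩
  have hsum : ∀ θ ∈ Ioo (0 : ℝ) 1, ∑' r, f r * θ ^ r =
      ∫ w, w ^ N * Real.exp (x * θ * w) ∂(productLaw ν₁ ν₂) := by
    intro θ hθ
    refine (h₁.hasSum_wrightTerm_mul_pow h₂ N x ?_).tsum_eq
    refine Summable.of_nonneg_of_le (fun _ => abs_nonneg _) (fun r => ?_)
      ((summable_geometric_of_lt_one hθ.1.le hθ.2).mul_left K)
    rw [abs_mul, abs_of_nonneg (pow_nonneg hθ.1.le r)]
    exact mul_le_mul_of_nonneg_right (hK r) (pow_nonneg hθ.1.le r)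
  have hev : ∀ᶠ θ in 𝓝[<] (1 : ℝ), θ ∈ Ioo (0 : ℝ) 1 := Ioo_mem_nhdsLT one_pos
  have hdct : Tendsto (fun θ : ℝ => ∫ w, w ^ N * Real.exp (x * θ * w) ∂(productLaw ν₁ ν₂)) (𝓝[<] 1)
      (𝓝 (∫ w, w ^ N * Real.exp (x * w) ∂(productLaw ν₁ ν₂))) := by
    refine tendsto_integral_filter_of_dominated_convergence (fun w => w ^ N) ?_ ?_
      (h₁.integrable_productLaw_pow h₂ N) ?_
    · exact Eventually.of_forall fun θ => (by fun_prop : Measurable _).aestronglyMeasurable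
    · filter_upwards [hev] with θ hθ
      filter_upwards [h₁.productLaw_nonneg h₂] with w hw
      rw [Real.norm_eq_abs, abs_of_nonneg (by positivity)]
      refine mul_le_of_le_one_right (by positivity) (Real.exp_le_one_iff.mpr ?_)
      exact mul_nonpos_of_nonpos_of_nonneg (mul_nonpos_of_nonpos_of_nonneg hx hθ.1.le) hw
    · refine ae_of_all _ fun w => ?_
      have h : Continuous fun θ : ℝ => w ^ N * Real.exp (x * θ * w) := by fun_prop
      simpa using (h.tendsto 1).mono_left nhdsWithin_le_nhds
  refine tendsto_nhds_unique habel (hdct.congr' ?_)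
  filter_upwards [hev] with θ hθ using (hsum θ hθ).symm

/-- The law of the number of points, mixed over the area, in terms of Wright functions. -/
theorem IsMLLaw.integral_poissonMass (h₁ : IsMLLaw α ν₁) (h₂ : IsMLLaw β ν₂) {k : ℕ}
    {l : Fin k → ℝ} (hl : ∀ j, 0 < l j) {c : ℝ} (hc : 0 ≤ c) (n : ℕ)
    (hconv : ∀ ν ∈ Theta k n, WrightConverges (wrightUpper (∑ j, ν j))
      (wrightLower α β (∑ j, ν j)) (-∑ j, l j * c)) :
    ∫ w, poissonMass (n : ℤ) (fun j => l j * (c * w)) ∂(productLaw ν₁ ν₂) =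
      ∑ ν ∈ Theta k n, (∏ j, (l j * c) ^ ν j / ((ν j).factorial : ℝ)) *
        generalizedWright (wrightUpper (∑ j, ν j)) (wrightLower α β (∑ j, ν j))
          (-∑ j, l j * c) := by
  have hx : -∑ j, l j * c ≤ 0 :=
    neg_nonpos.mpr (Finset.sum_nonneg fun j _ => mul_nonneg (hl j).le hc)
  have hw : ∀ (ν : Fin k → ℕ) (w : ℝ), poissonWeight (fun j => l j * (c * w)) ν =
      (∏ j, (l j * c) ^ ν j / ((ν j).factorial : ℝ)) *
        (w ^ (∑ j, ν j) * Real.exp ((-∑ j, l j * c) * w)) := by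
    intro ν w
    rw [poissonWeight, Finset.prod_mul_distrib, ← Real.exp_sum, ← Finset.prod_pow_eq_pow_sum,
      ← mul_assoc, ← Finset.prod_mul_distrib]
    congr 1
    · refine Finset.prod_congr rfl fun j _ => ?_
      rw [← mul_assoc, mul_pow _ w]
      ring
    · rw [Finset.sum_neg_distrib, neg_mul, Finset.sum_mul]
      simp_rw [mul_assoc]
  have hi : ∀ N : ℕ, Integrable (fun w => w ^ N * Real.exp ((-∑ j, l j * c) * w))
      (productLaw ν₁ ν₂) := by
    intro N
    refine h₁.integrable_productLaw_of_le h₂ (C := 1) (r := N) (by fun_prop) fun w hw => ?_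
    rw [one_mul, abs_of_nonneg (by positivity)]
    refine mul_le_of_le_one_right (by positivity) (Real.exp_le_one_iff.mpr ?_)
    exact mul_nonpos_of_nonpos_of_nonneg hx hw
  simp_rw [poissonMass_natCast, hw]
  rw [integral_finsetSum _ fun ν _ => (hi _).const_mul _]
  refine Finset.sum_congr rfl fun ν hν => ?_
  rw [integral_const_mul, h₁.generalizedWright_eq h₂ _ hx (hconv ν hν)]

end Wright

/-! ### Subordination of generalized Poisson random fields -/

/-- The index of the right end point of the cell of `x` in the grid of mesh `1 / (m + 1)`. -/
noncomputable def gridIndex (m : ℕ) (x : ℝ≥0) : ℕ := ⌊((m : ℝ≥0) + 1) * x⌋₊ + 1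

/-- The points of the grid of mesh `1 / (m + 1)`. -/
noncomputable def gridPoint (m i : ℕ) : ℝ≥0 := (i : ℝ≥0) / ((m : ℝ≥0) + 1)

@[fun_prop]
theorem measurable_gridIndex (m : ℕ) : Measurable (gridIndex m) :=
  (Nat.measurable_floor.comp (measurable_const_mul _)).add_const 1

theorem le_gridPoint (m : ℕ) (x : ℝ≥0) : x ≤ gridPoint m (gridIndex m x) := by
  rw [gridPoint, gridIndex, le_div_iff₀ (by positivity), mul_comm]
  exact_mod_cast (Nat.lt_floor_add_one (((m : ℝ≥0) + 1) * x)).le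

theorem gridPoint_le (m : ℕ) (x : ℝ≥0) : gridPoint m (gridIndex m x) ≤ x + 1 / ((m : ℝ≥0) + 1) := by
  have h : (0 : ℝ≥0) < (m : ℝ≥0) + 1 := by positivity
  rw [gridPoint, gridIndex, div_le_iff₀ h, add_mul x, one_div_mul_cancel h.ne', mul_comm x]
  push_cast
  gcongr
  exact Nat.floor_le (zero_le)

theorem tendsto_gridPoint (x : ℝ≥0) :
    Tendsto (fun m => gridPoint m (gridIndex m x)) atTop (𝓝 x) := by
  refine tendsto_of_tendsto_of_tendsto_of_le_of_le tendsto_const_nhds ?_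
    (fun m => le_gridPoint m x) (fun m => gridPoint_le m x)
  have h : Tendsto (fun m : ℕ => 1 / ((m : ℝ≥0) + 1)) atTop (𝓝 0) :=
    tendsto_one_div_add_atTop_nhds_zero_nat
  simpa using h.const_add x

theorem IsFGPRF.measure_inter {Ω : Type*} [MeasurableSpace Ω] {μ : Measure Ω} {k : ℕ}
    {l : Fin k → ℝ} {M : ℝ≥0 → ℝ≥0 → Ω → ℕ} {α β : ℝ} {Lα Lβ : ℝ≥0 → Ω → ℝ≥0}
    (h : IsFGPRF α β l M Lα Lβ μ) (s t a b : ℝ≥0) (n : ℕ)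
    {B C : Set ℝ≥0} (hB : MeasurableSet B) (hC : MeasurableSet C) :
    μ ({ω | M a b ω = n} ∩ (Lα s ⁻¹' B ∩ Lβ t ⁻¹' C)) =
      μ {ω | M a b ω = n} * (μ (Lα s ⁻¹' B) * μ (Lβ t ⁻¹' C)) := by
  have key := h.indep.meas_iInter
    (s := ![{ω | M a b ω = n}, Lα s ⁻¹' B, Lβ t ⁻¹' C]) (fun i => ?_)
  · rw [Fin.prod_univ_three] at key
    simp only [Matrix.cons_val_zero, Matrix.cons_val_one, Matrix.cons_val_two, Matrix.head_cons,
      Matrix.tail_cons, mul_assoc] at key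
    rw [← key]
    congr 1
    ext ω
    simp [Fin.forall_fin_succ]
  · fin_cases i
    · exact ⟨(fun f : ℝ≥0 × ℝ≥0 → ℕ => f (a, b)) ⁻¹' {n},
        (measurable_pi_apply (a, b)) (measurableSet_singleton n), rfl⟩
    · exact ⟨(fun f : ℝ≥0 → ℝ≥0 => f s) ⁻¹' B, (measurable_pi_apply s) hB, rfl⟩
    · exact ⟨(fun f : ℝ≥0 → ℝ≥0 => f t) ⁻¹' C, (measurable_pi_apply t) hC, rfl⟩

section Subordination

variable {Ω : Type*} [MeasurableSpace Ω] {μ : Measure Ω} [IsProbabilityMeasure μ] {k : ℕ}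
  {l : Fin k → ℝ} {M : ℝ≥0 → ℝ≥0 → Ω → ℕ}

theorem IsGPRF.measure_eq (hM : IsGPRF l M μ) {a b : ℝ≥0} (ha : 0 < a) (hb : 0 < b) (n : ℕ) :
    μ {ω | M a b ω = n} =
      ENNReal.ofReal (poissonMass (n : ℤ) fun j => l j * ((a : ℝ) * b)) := by
  have h := hM.law_inc 0 0 a b ha hb n
  rw [gprfPmf_eq] at h
  simp only [NNReal.coe_zero, sub_zero] at h
  rw [← h, ofReal_measureReal]
  refine measure_congr ?_
  filter_upwards [hM.zero_left 0, hM.zero_left b, hM.zero_right a] with ω h1 h2 h3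
  refine propext ?_
  change M a b ω = n ↔ rectInc M 0 0 a b ω = n
  simp [rectInc, h1, h2, h3]

variable {X Y : Ω → ℝ≥0}

/-- `M` is not assumed jointly measurable, so conditioning on `(X, Y)` is done on a grid: on each of
countably many cells the field is evaluated at a fixed point, and `hI` factorizes the probability.
-/
theorem IsGPRF.measure_grid_eq (hM : IsGPRF l M μ) (hX : Measurable X) (hY : Measurable Y)
    (hI : ∀ (a b : ℝ≥0) (n : ℕ) (B C : Set ℝ≥0), MeasurableSet B → MeasurableSet C →
      μ ({ω | M a b ω = n} ∩ (X ⁻¹' B ∩ Y ⁻¹' C)) = μ {ω | M a b ω = n} * (μ (X ⁻¹' B) * μ (Y ⁻¹' C)))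
    (m n : ℕ) :
    MeasurableSet {ω | M (gridPoint m (gridIndex m (X ω))) (gridPoint m (gridIndex m (Y ω))) ω = n} ∧
    μ {ω | M (gridPoint m (gridIndex m (X ω))) (gridPoint m (gridIndex m (Y ω))) ω = n} =
      ∫⁻ z, ENNReal.ofReal (poissonMass (n : ℤ) fun j => l j *
        ((gridPoint m (gridIndex m z.1) : ℝ) * gridPoint m (gridIndex m z.2)))
        ∂((μ.map X).prod (μ.map Y)) := by
  have := Measure.isProbabilityMeasure_map (μ := μ) hX.aemeasurable
  have := Measure.isProbabilityMeasure_map (μ := μ) hY.aemeasurable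
  have hd := measurable_gridIndex m
  set S : ℕ × ℕ → Set Ω := fun p => {ω | M (gridPoint m p.1) (gridPoint m p.2) ω = n} ∩
    (X ⁻¹' (gridIndex m ⁻¹' {p.1}) ∩ Y ⁻¹' (gridIndex m ⁻¹' {p.2})) with hS
  have hBm : ∀ i, MeasurableSet (gridIndex m ⁻¹' {i}) := fun i => hd (measurableSet_singleton i)
  have hSm : ∀ p, MeasurableSet (S p) := fun p =>
    (hM.meas _ _ (measurableSet_singleton n)).inter ((hX (hBm _)).inter (hY (hBm _)))
  have hU : {ω | M (gridPoint m (gridIndex m (X ω))) (gridPoint m (gridIndex m (Y ω))) ω = n} =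
      ⋃ p, S p := by
    ext ω
    simp only [hS, mem_iUnion, mem_inter_iff, mem_ofPred_eq, mem_preimage, mem_singleton_iff]
    constructor
    · intro h
      exact ⟨(gridIndex m (X ω), gridIndex m (Y ω)), h, rfl, rfl⟩
    · rintro ⟨p, h, h1, h2⟩
      rw [h1, h2, h]
  have hdisj : Pairwise (Function.onFun Disjoint S) := by
    intro p p' hp
    refine Set.disjoint_left.mpr fun ω h h' => hp ?_
    simp only [hS, mem_inter_iff, mem_preimage, mem_singleton_iff] at h h'
    exact Prod.ext (h.2.1.symm.trans h'.2.1) (h.2.2.symm.trans h'.2.2)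
  rw [hU]
  refine ⟨MeasurableSet.iUnion hSm, ?_⟩
  rw [measure_iUnion hdisj hSm]
  have hint := lintegral_map (μ := (μ.map X).prod (μ.map Y))
    (f := fun p : ℕ × ℕ => ENNReal.ofReal (poissonMass (n : ℤ) fun j => l j *
      ((gridPoint m p.1 : ℝ) * gridPoint m p.2)))
    (g := Prod.map (gridIndex m) (gridIndex m)) (measurable_of_countable _) (hd.prodMap hd)
  refine Eq.trans ?_ hint
  rw [← Measure.map_prod_map _ _ hd hd, lintegral_countable']
  refine tsum_congr fun p => ?_
  rw [hS]
  simp only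
  rw [hI _ _ _ _ _ (hBm _) (hBm _), ← singleton_prod_singleton, Measure.prod_prod,
    Measure.map_apply hd (measurableSet_singleton _), Measure.map_apply hd (measurableSet_singleton _),
    Measure.map_apply hX (hBm _), Measure.map_apply hY (hBm _)]
  -- `gridIndex` never vanishes, so cells of index `0` are empty and only grid points with positive
  -- coordinates remain, as `measure_eq` requires.
  rcases Nat.eq_zero_or_pos p.1 with h | h1
  · have : gridIndex m ⁻¹' {p.1} = ∅ := by
      ext x
      simp [h, gridIndex]
    simp [this]
  rcases Nat.eq_zero_or_pos p.2 with h | h2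
  · have : gridIndex m ⁻¹' {p.2} = ∅ := by
      ext x
      simp [h, gridIndex]
    simp [this]
  rw [hM.measure_eq (by unfold gridPoint; positivity) (by unfold gridPoint; positivity)]

/-- The grid points approach `(X, Y)` from the upper right, and an integer-valued right-continuous
path is eventually constant along them. The grid formula thus passes to the limit on both sides. -/
theorem IsGPRF.measureReal_subordinated (hM : IsGPRF l M μ) (hX : Measurable X) (hY : Measurable Y)
    (hI : ∀ (a b : ℝ≥0) (n : ℕ) (B C : Set ℝ≥0), MeasurableSet B → MeasurableSet C →
      μ ({ω | M a b ω = n} ∩ (X ⁻¹' B ∩ Y ⁻¹' C)) = μ {ω | M a b ω = n} * (μ (X ⁻¹' B) * μ (Y ⁻¹' C)))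
    (n : ℕ) :
    μ.real {ω | M (X ω) (Y ω) ω = n} =
      ∫ z, poissonMass (n : ℤ) (fun j => l j * ((z.1 : ℝ) * z.2)) ∂((μ.map X).prod (μ.map Y)) := by
  have := Measure.isProbabilityMeasure_map (μ := μ) hX.aemeasurable
  have := Measure.isProbabilityMeasure_map (μ := μ) hY.aemeasurable
  have hcont := continuous_poissonMass_area l (n : ℤ)
  set Z : ℕ → Ω → ℕ := fun m ω =>
    M (gridPoint m (gridIndex m (X ω))) (gridPoint m (gridIndex m (Y ω))) ω with hZ
  have hZm : ∀ m, Measurable (Z m) := fun m => by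
    refine measurable_to_countable' fun n => ?_
    exact (hM.measure_grid_eq hX hY hI m n).1
  have hev : ∀ᵐ ω ∂μ, ∀ᶠ m in atTop, Z m ω = M (X ω) (Y ω) ω := by
    filter_upwards [hM.rightCont] with ω hω
    have h1 : Tendsto (fun m => (gridPoint m (gridIndex m (X ω)), gridPoint m (gridIndex m (Y ω))))
        atTop (𝓝[Ici (X ω, Y ω)] (X ω, Y ω)) := by
      refine tendsto_nhdsWithin_iff.mpr ⟨(tendsto_gridPoint _).prodMk_nhds (tendsto_gridPoint _),
        Eventually.of_forall fun m => ?_⟩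
      exact ⟨le_gridPoint _ _, le_gridPoint _ _⟩
    have h2 := (hω (X ω, Y ω)).tendsto.comp h1
    rw [nhds_discrete, tendsto_pure] at h2
    exact h2
  have hlim1 : Tendsto (fun m => μ.real {ω | Z m ω = n}) atTop
      (𝓝 (μ.real {ω | M (X ω) (Y ω) ω = n})) := by
    have hae : AEMeasurable (fun ω => M (X ω) (Y ω) ω) μ := by
      refine aemeasurable_of_tendsto_metrizable_ae atTop (fun m => (hZm m).aemeasurable) ?_
      filter_upwards [hev] with ω hω
      exact tendsto_const_nhds.congr' (hω.mono fun m h => h.symm)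
    have hcongr : {ω | M (X ω) (Y ω) ω = n} =ᵐ[μ] {ω | hae.mk _ ω = n} := by
      filter_upwards [hae.ae_eq_mk] with ω hω
      refine propext ?_
      change M (X ω) (Y ω) ω = n ↔ hae.mk _ ω = n
      rw [hω]
    rw [measureReal_congr hcongr]
    refine (ENNReal.tendsto_toReal (measure_ne_top _ _)).comp
      (tendsto_measure_of_ae_tendsto_indicator_of_isFiniteMeasure atTop
        (hae.measurable_mk (measurableSet_singleton n))
        (fun m => hZm m (measurableSet_singleton n)) ?_)
    filter_upwards [hev, hae.ae_eq_mk] with ω hω h2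
    filter_upwards [hω] with m hm
    rw [h2] at hm
    rw [hm]
  have hval : ∀ m, μ.real {ω | Z m ω = n} =
      ∫ z, poissonMass (n : ℤ) (fun j => l j *
        ((gridPoint m (gridIndex m z.1) : ℝ) * gridPoint m (gridIndex m z.2)))
        ∂((μ.map X).prod (μ.map Y)) := by
    intro m
    rw [measureReal_def, (hM.measure_grid_eq hX hY hI m n).2, integral_eq_lintegral_of_nonneg_ae]
    · exact ae_of_all _ fun z => poissonMass_nonneg _ fun j =>
        mul_nonneg (hM.rates_pos j).le (by positivity)
    · refine Measurable.aestronglyMeasurable ?_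
      refine hcont.measurable.comp (Measurable.mul ?_ ?_)
      · exact (measurable_of_countable (fun i => (gridPoint m i : ℝ))).comp
          ((measurable_gridIndex m).comp measurable_fst)
      · exact (measurable_of_countable (fun i => (gridPoint m i : ℝ))).comp
          ((measurable_gridIndex m).comp measurable_snd)
  refine tendsto_nhds_unique hlim1 ?_
  simp_rw [hval]
  refine tendsto_integral_of_dominated_convergence (fun _ => ((Theta k n).card : ℝ)) ?_
    (integrable_const _) ?_ ?_
  · intro m
    refine Measurable.aestronglyMeasurable ?_
    refine hcont.measurable.comp (Measurable.mul ?_ ?_)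
    · exact (measurable_of_countable (fun i => (gridPoint m i : ℝ))).comp
        ((measurable_gridIndex m).comp measurable_fst)
    · exact (measurable_of_countable (fun i => (gridPoint m i : ℝ))).comp
        ((measurable_gridIndex m).comp measurable_snd)
  · exact fun m => ae_of_all _ fun z => abs_poissonMass_le _ fun j =>
      mul_nonneg (hM.rates_pos j).le (by positivity)
  · refine ae_of_all _ fun z => (hcont.tendsto _).comp ?_
    exact (((NNReal.continuous_coe.tendsto _).comp (tendsto_gridPoint z.1)).mul
      ((NNReal.continuous_coe.tendsto _).comp (tendsto_gridPoint z.2)))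

variable {α β : ℝ} {Lα Lβ : ℝ≥0 → Ω → ℝ≥0}

/-- The one-dimensional law of a fractional generalized Poisson random field as a mixture. -/
theorem IsFGPRF.exists_law (h : IsFGPRF α β l M Lα Lβ μ) :
    ∃ ν₁ ν₂, IsMLLaw α ν₁ ∧ IsMLLaw β ν₂ ∧ ∀ (n : ℤ) (s t : ℝ), 0 ≤ s → 0 ≤ t →
      fgprfProb M Lα Lβ μ n s t =
        ∫ w, poissonMass n (fun j => l j * (s ^ α * t ^ β * w)) ∂(productLaw ν₁ ν₂) := by
  obtain ⟨ν₁, h₁, hlaw₁⟩ := h.inv_left.exists_law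
  obtain ⟨ν₂, h₂, hlaw₂⟩ := h.inv_right.exists_law
  have := h₁.prob
  have := h₂.prob
  refine ⟨ν₁, ν₂, h₁, h₂, fun n s t hs ht => ?_⟩
  rcases lt_or_ge n 0 with hn | hn
  · have h0 : {ω | (M (Lα s.toNNReal ω) (Lβ t.toNNReal ω) ω : ℤ) = n} = ∅ := by
      ext ω
      simp only [mem_ofPred_eq, mem_empty_iff_false, iff_false]
      omega
    simp [fgprfProb, h0, poissonMass_of_neg hn]
  lift n to ℕ using hn
  lift s to ℝ≥0 using hs
  lift t to ℝ≥0 using ht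
  obtain ⟨hX, hXl⟩ := hlaw₁ s
  obtain ⟨hY, hYl⟩ := hlaw₂ t
  have hcont := continuous_poissonMass_area l (n : ℤ)
  -- The time changes are only a.e. measurable; their measurable versions inherit the factorization.
  have hI : ∀ (a b : ℝ≥0) (n : ℕ) (B C : Set ℝ≥0), MeasurableSet B → MeasurableSet C →
      μ ({ω | M a b ω = n} ∩ (hX.mk _ ⁻¹' B ∩ hY.mk _ ⁻¹' C)) =
        μ {ω | M a b ω = n} * (μ (hX.mk _ ⁻¹' B) * μ (hY.mk _ ⁻¹' C)) := by
    intro a b n B C hB hC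
    have e1 : hX.mk _ ⁻¹' B =ᵐ[μ] Lα s ⁻¹' B := hX.ae_eq_mk.symm.preimage B
    have e2 : hY.mk _ ⁻¹' C =ᵐ[μ] Lβ t ⁻¹' C := hY.ae_eq_mk.symm.preimage C
    rw [measure_congr e1, measure_congr e2,
      measure_congr ((ae_eq_refl _).inter (e1.inter e2)), h.measure_inter s t a b n hB hC]
  have key := h.gprf.measureReal_subordinated hX.measurable_mk hY.measurable_mk hI n
  have e0 : fgprfProb M Lα Lβ μ n s t = μ.real {ω | M (hX.mk _ ω) (hY.mk _ ω) ω = n} := by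
    rw [fgprfProb, Real.toNNReal_coe, Real.toNNReal_coe]
    refine measureReal_congr ?_
    filter_upwards [hX.ae_eq_mk, hY.ae_eq_mk] with ω e1 e2
    refine propext ?_
    change (M (Lα s ω) (Lβ t ω) ω : ℤ) = n ↔ M (hX.mk _ ω) (hY.mk _ ω) ω = n
    rw [← e1, ← e2, Nat.cast_inj]
  have m1 : (μ.map (hX.mk _)).map ((↑) : ℝ≥0 → ℝ) = ν₁.map fun x => (s : ℝ) ^ α * x := by
    rw [← hXl, Measure.map_map measurable_coe_nnreal_real hX.measurable_mk]
    refine Measure.map_congr ?_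
    filter_upwards [hX.ae_eq_mk] with ω e1
    simp [e1]
  have m2 : (μ.map (hY.mk _)).map ((↑) : ℝ≥0 → ℝ) = ν₂.map fun x => (t : ℝ) ^ β * x := by
    rw [← hYl, Measure.map_map measurable_coe_nnreal_real hY.measurable_mk]
    refine Measure.map_congr ?_
    filter_upwards [hY.ae_eq_mk] with ω e1
    simp [e1]
  have := Measure.isProbabilityMeasure_map (μ := μ) hX.measurable_mk.aemeasurable
  have := Measure.isProbabilityMeasure_map (μ := μ) hY.measurable_mk.aemeasurable
  have hg : Measurable fun z : ℝ × ℝ => poissonMass (n : ℤ) fun j => l j * (z.1 * z.2) :=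
    hcont.measurable.comp (measurable_fst.mul measurable_snd)
  have i1 := integral_map (μ := (μ.map (hX.mk _)).prod (μ.map (hY.mk _)))
    (φ := Prod.map ((↑) : ℝ≥0 → ℝ) ((↑) : ℝ≥0 → ℝ))
    (measurable_coe_nnreal_real.prodMap measurable_coe_nnreal_real).aemeasurable
    hg.aestronglyMeasurable
  rw [← Measure.map_prod_map _ _ measurable_coe_nnreal_real measurable_coe_nnreal_real, m1, m2,
    Measure.map_prod_map _ _ (measurable_const_mul _) (measurable_const_mul _),
    integral_map ((measurable_const_mul _).prodMap (measurable_const_mul _)).aemeasurable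
      hg.aestronglyMeasurable] at i1
  rw [e0, key]
  refine i1.symm.trans ?_
  rw [integral_productLaw (g := fun w => poissonMass (n : ℤ) fun j =>
    l j * ((s : ℝ) ^ α * (t : ℝ) ^ β * w)) (hcont.measurable.comp (measurable_const_mul _))]
  refine integral_congr_ae (ae_of_all _ fun z => ?_)
  simp only [Prod.map_fst, Prod.map_snd]
  congr 1
  ext j
  ring

end Subordination

/-! ### The main theorem -/

theorem mainTheorem2 (k : ℕ) [NeZero k] (α β : ℝ) (hα : α ∈ Ioc (0 : ℝ) 1)
    (hβ : β ∈ Ioc (0 : ℝ) 1) :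
    -- the one-dimensional law
    (∀ (Ω : Type u) [MeasurableSpace Ω] (μ : Measure Ω) [IsProbabilityMeasure μ]
        (l : Fin k → ℝ) (M : ℝ≥0 → ℝ≥0 → Ω → ℕ) (Lα Lβ : ℝ≥0 → Ω → ℝ≥0),
        IsFGPRF α β l M Lα Lβ μ →
        ∀ (n : ℕ) (s t : ℝ), 0 ≤ s → 0 ≤ t →
          (∀ ν ∈ Theta k n, WrightConverges (wrightUpper (∑ j, ν j))
            (wrightLower α β (∑ j, ν j)) (-∑ j, l j * s ^ α * t ^ β)) →
          fgprfProb M Lα Lβ μ n s t =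
            ∑ ν ∈ Theta k n,
              (∏ j, (l j * s ^ α * t ^ β) ^ ν j / ((ν j).factorial : ℝ)) *
                generalizedWright (wrightUpper (∑ j, ν j)) (wrightLower α β (∑ j, ν j))
                  (-∑ j, l j * s ^ α * t ^ β)) ∧
    -- the series of the Wright functions converge everywhere if `α + β > 1`
    (1 < α + β → ∀ (N : ℕ) (x : ℝ),
        WrightConverges (wrightUpper N) (wrightLower α β N) x) ∧
    -- the system of fractional differential equations
    (∀ (Ω : (Fin k → ℝ) → Type u) [∀ l, MeasurableSpace (Ω l)] (μ : ∀ l, Measure (Ω l))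
        [∀ l, IsProbabilityMeasure (μ l)] (M : ∀ l, ℝ≥0 → ℝ≥0 → Ω l → ℕ)
        (Lα Lβ : ∀ l, ℝ≥0 → Ω l → ℝ≥0),
        (∀ l, (∀ j, 0 < l j) → IsFGPRF α β l (M l) (Lα l) (Lβ l) (μ l)) →
        ∀ p : (Fin k → ℝ) → ℤ → ℝ → ℝ → ℝ,
          (p = fun l n s t => fgprfProb (M l) (Lα l) (Lβ l) (μ l) n s t) →
          ∀ l : Fin k → ℝ, (∀ j, 0 < l j) →
            p l 0 0 0 = 1 ∧ (∀ n < 0, ∀ s t, p l n s t = 0) ∧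
            ∀ (n : ℕ) (s t : ℝ), 0 < s → 0 < t →
              CaputoDifferentiableAt α (fun s' => p l n s' t) s ∧
              CaputoDifferentiableAt β
                (fun t' => caputoDeriv α (fun s' => p l n s' t') s) t ∧
              DifferentiableAt ℝ (fun x => p (Function.update l 0 x) n s t) (l 0) ∧
              caputoDeriv β (fun t' => caputoDeriv α (fun s' => p l n s' t') s) t =
                governingOperator (fun l' m => p l' m s t) l n) := by
  refine ⟨?_, fun h N x => wrightConverges_of_one_lt hα hβ h N x, ?_⟩
  · intro Ω _ μ _ l M Lα Lβ h n s t hs ht hconv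
    obtain ⟨ν₁, ν₂, h₁, h₂, hlaw⟩ := h.exists_law
    have e : ∀ j, l j * s ^ α * t ^ β = l j * (s ^ α * t ^ β) := fun j => mul_assoc _ _ _
    simp only [e] at hconv ⊢
    rw [hlaw n s t hs ht, h₁.integral_poissonMass h₂ h.gprf.rates_pos (by positivity) n hconv]
  · intro Ω _ μ _ M Lα Lβ h p hp l hl
    obtain ⟨ν₁, ν₂, h₁, h₂, hlaw⟩ := (h l hl).exists_law
    have := h₁.isProbabilityMeasure_productLaw h₂
    have hnn := h₁.productLaw_nonneg h₂
    have hpow := h₁.integrable_productLaw_pow h₂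
    -- The probability space varies with the rates, but Mittag-Leffler laws are unique, so one
    -- mixing law serves all rates and `∂/∂λ₁` can be taken under the integral.
    have hF : ∀ l : Fin k → ℝ, (∀ j, 0 < l j) → ∀ (n : ℤ) (s t : ℝ), 0 ≤ s → 0 ≤ t →
        p l n s t = ∫ w, poissonMass n (fun j => l j * (s ^ α * t ^ β * w))
          ∂(productLaw ν₁ ν₂) := by
      intro l' hl' n s t hs ht
      obtain ⟨ν₁', ν₂', h₁', h₂', hlaw'⟩ := (h l' hl').exists_law
      rw [hp, h₁.ext hα h₁', h₂.ext hβ h₂']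
      exact hlaw' n s t hs ht
    refine ⟨?_, fun n hn s t => ?_, fun n s t hs ht => ?_⟩
    · rw [hF l hl 0 0 0 le_rfl le_rfl, Real.zero_rpow hα.1.ne']
      have h0 : poissonMass (0 : ℤ) (fun _ : Fin k => (0 : ℝ)) = 1 := by
        have hT : Theta k 0 = {0} := by
          ext ν
          simp [mem_Theta, funext_iff]
        rw [← Nat.cast_zero, poissonMass_natCast, hT]
        simp [poissonWeight]
      simp [h0]
    · subst hp
      have h0 : {ω | (M l (Lα l s.toNNReal ω) (Lβ l t.toNNReal ω) ω : ℤ) = n} = ∅ := by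
        ext ω
        simp only [mem_ofPred_eq, mem_empty_iff_false, iff_false]
        omega
      simp [fgprfProb, h0]
    · have hc : 0 < s ^ α * t ^ β := by positivity
      have hF' : ∀ l : Fin k → ℝ, (∀ j, 0 < l j) → ∀ m, p l m s t =
          ∫ w, poissonMass m (fun j => l j * (s ^ α * t ^ β * w)) ∂(productLaw ν₁ ν₂) :=
        fun l hl m => hF l hl m s t hs.le ht.le
      have hd1 := hasDerivAt_poissonMass_area l
      have hd2 := fun m x => hasDerivAt_shiftOp l (g := fun m a => poissonMass m fun j => l j * a)
        (g' := fun m a => shiftOp l (fun m => poissonMass m fun j => l j * a) m)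
        (fun n => hd1 n x) m
      -- The third derivative serves only to make the second one continuous, hence measurable.
      have hd3 := fun m x => hasDerivAt_shiftOp l
        (g := fun m a => shiftOp l (fun m => poissonMass m fun j => l j * a) m)
        (g' := fun m a => shiftOp l (fun m => shiftOp l (fun m => poissonMass m fun j => l j * a) m) m)
        (fun n => hd2 n x) m
      obtain ⟨C, hC⟩ := exists_bound_poissonMass hl (n : ℤ)
      obtain ⟨C₁, hC₁⟩ := exists_bound_shiftOp l (exists_bound_poissonMass hl) n
      obtain ⟨C₂, hC₂⟩ := exists_bound_shiftOp l
        (exists_bound_shiftOp l (exists_bound_poissonMass hl)) n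
      have key := h₁.caputo_pair hα hβ h₂ (hd1 n) (hd2 n)
        (continuous_iff_continuousAt.mpr fun x => (hd3 n x).continuousAt).measurable
        (C := max C (max C₁ C₂)) (fun x hx => (hC x hx).trans (le_max_left _ _))
        (fun x hx => (hC₁ x hx).trans ((le_max_left _ _).trans (le_max_right _ _)))
        (fun x hx => (hC₂ x hx).trans ((le_max_right _ _).trans (le_max_right _ _)))
        (P := fun s t => p l n s t) (fun s t hs ht => hF l hl n s t hs.le ht.le) hs ht
      refine ⟨key.1, key.2.1, ?_, ?_⟩
      · exact (hasDerivAt_rate_integral (F := fun l' m => p l' m s t) hnn hpow hc.le hF' hl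
          n).differentiableAt
      · rw [key.2.2, governingOperator_integral (F := fun l' m => p l' m s t) hnn hpow hc.le hF' hl]
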